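/- **Conventions.** A polyhedral complex $\Sigma$ in $\mathbb{R}^n$ is a set of nonempty polyhedra (its cells), closed under taking nonempty faces, such that any two cells are disjoint or meet in a common face, and which is locally finite: every point of the support $|\Sigma|=\bigcup_{\sigma\in\Sigma}\sigma$ has a neighbourhood that meets only finitely many cells (for instance, $\Sigma$ is finite). Its facets are the cells of largest dimension and its ridges are the cells of dimension one less; $\Sigma$ is pure if every cell lies in a facet, and connected if $|\Sigma|$ is (nonempty and) connected. The facet-ridge graph $G(\Sigma)$ has the facets as vertices, and two distinct facets are adjacent if they intersect in a ridge. $\Sigma$ is connected through codimension one if $G(\Sigma)$ is connected. For $w\in|\Sigma|$ the star $\operatorname{Star}_w(\Sigma)$ is the fan of the cones $\{v : w+\varepsilon v\in\sigma \text{ for all sufficiently small } \varepsilon>0\}$, over all cells $\sigma\ni w$; $\Sigma$ is locally connected through codimension one if $G(\operatorname{Star}_w(\Sigma))$ is connected for all $w\in|\Sigma|$. The Bergman fan of a matroid $M$ on $[m]$ is $B(M)=\{x\in\mathbb{R}^m : \min_{i\in C}x_i \text{ is attained at least twice for every circuit } C \text{ of } M\}$. A $d$-dimensional tropical manifold is a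 polyhedral complex $\Sigma$ such that for every $w\in|\Sigma|$ the fan $\operatorname{Star}_w(\Sigma)$ has dimension $d$ and its support is linearly isomorphic to $B(M)$, or to the image of $B(M)$ in $\mathbb{R}^m/\mathbb{R}(1,\dots,1)$, for some matroid $M$ on some $[m]$. (Linearly isomorphic: a linear isomorphism of the linear spans maps one set onto the other.) Let $\mathbb{T}=(\mathbb{R}\cup\{\infty\},\min,+)$. A valuated matroid is a subsemimodule $\mathcal{V}\subseteq\mathbb{T}^n$ such that for all $G,H\in\mathcal{V}$ and every $e$ with $G_e=H_e$ there is $F\in\mathcal{V}$ with $F_e=\infty$ and $F_i\ge\min(G_i,H_i)$ for all $i\ne e$, with equality whenever $G_i\neq H_i$. Its tropical linear space $\operatorname{trop}(\mathcal{V})\subseteq\mathbb{T}^n$ is the set of all $x$ such that for every $v\in\mathcal{V}$ the minimum $\min_i(v_i+x_i)$ is $\infty$ or is attained at least twice. Let $L$ be the set of coordinates that equal $\infty$ on all of $\operatorname{trop}(\mathcal{V})$; deleting these coordinates, regard $\operatorname{trop}(\mathcal{V})^{\circ}=\{x\in\operatorname{trop}(\mathcal{V}) : x_i<\infty \text{ for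 } i\notin L\}$ as a subset of $\mathbb{R}^{[n]\setminus L}$ (it is $\operatorname{trop}(\mathcal{V})\cap\mathbb{R}^n$ if $L=\emptyset$). **Theorem.** 1. A connected pure polyhedral complex in $\mathbb{R}^n$ that is locally connected through codimension one is connected through codimension one. 2. Every connected tropical manifold in $\mathbb{R}^n$ is connected through codimension one. 3. Tropical linear spaces are connected through codimension one. That is, for every valuated matroid $\mathcal{V}\subseteq\mathbb{T}^n$, the set $\operatorname{trop}(\mathcal{V})^{\circ}$ is the support of a finite polyhedral complex, and every polyhedral complex with this support is a connected tropical manifold and is connected through codimension one. -/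

import Mathlib

open scoped Topology

namespace TropicalConnectivity

/-! ### Polyhedral complexes in `ℝ^ι`, for a finite index type `ι` -/

section Polyhedral

variable {ι : Type*}

/-- A polyhedron in `ℝ^ι`: the solution set of finitely many (weak) linear inequalities. -/
def IsPolyhedron (P : Set (ι → ℝ)) : Prop :=
  ∃ s : Finset (((ι → ℝ) →ₗ[ℝ] ℝ) × ℝ), P = {x | ∀ a ∈ s, a.1 x ≤ a.2}

/-- `F` is a (nonempty) face of `P`: the locus in `P` where some linear functional is maximal. -/
def IsFace (F P : Set (ι → ℝ)) : Prop :=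
  F.Nonempty ∧ IsExposed ℝ P F

/-- A polyhedral complex in `ℝ^ι`, given as the set of its cells: nonempty polyhedra, closed under
taking faces, any two of which are disjoint or meet in a common face. The complex may be infinite,
but every point of its support has a neighbourhood that meets only finitely many cells. -/
structure IsPolyhedralComplex (S : Set (Set (ι → ℝ))) : Prop where
  isPolyhedron : ∀ σ ∈ S, IsPolyhedron σ
  nonempty : ∀ σ ∈ S, σ.Nonempty
  face_mem : ∀ σ ∈ S, ∀ F, IsFace F σ → F ∈ S
  inter_face : ∀ σ ∈ S, ∀ τ ∈ S, (σ ∩ τ).Nonempty → IsFace (σ ∩ τ) σ ∧ IsFace (σ ∩ τ) τ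
  locallyFinite : ∀ x ∈ ⋃₀ S, ∃ U ∈ 𝓝 x, {σ ∈ S | (σ ∩ U).Nonempty}.Finite

/-- The support `|S|` of a polyhedral complex. -/
def support (S : Set (Set (ι → ℝ))) : Set (ι → ℝ) := ⋃₀ S

/-- The dimension of a nonempty cell: the dimension of its affine span. -/
noncomputable def cellDim (σ : Set (ι → ℝ)) : ℕ := Module.finrank ℝ (vectorSpan ℝ σ)

/-- A complex has dimension `d` if `d` is the largest dimension of one of its cells. -/
def HasDim (S : Set (Set (ι → ℝ))) (d : ℕ) : Prop :=
  (∃ σ ∈ S, cellDim σ = d) ∧ ∀ σ ∈ S, cellDim σ ≤ d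

/-- A facet is a cell of the largest dimension. -/
def IsFacet (S : Set (Set (ι → ℝ))) (σ : Set (ι → ℝ)) : Prop :=
  σ ∈ S ∧ ∀ τ ∈ S, cellDim τ ≤ cellDim σ

/-- A ridge is a cell of codimension one. -/
def IsRidge (S : Set (Set (ι → ℝ))) (ρ : Set (ι → ℝ)) : Prop :=
  ρ ∈ S ∧ ∃ σ, IsFacet S σ ∧ cellDim ρ + 1 = cellDim σ

/-- A complex is pure if every cell lies in a cell of the largest dimension. -/
def IsPure (S : Set (Set (ι → ℝ))) : Prop :=
  ∀ σ ∈ S, ∃ τ, IsFacet S τ ∧ σ ⊆ τ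

/-- The facet-ridge graph `G(S)`: its vertices are the facets, and two distinct facets are adjacent
if they intersect along a ridge. -/
def facetRidgeGraph (S : Set (Set (ι → ℝ))) : SimpleGraph {σ // IsFacet S σ} where
  Adj σ τ := σ ≠ τ ∧ IsRidge S (σ.1 ∩ τ.1)
  symm := ⟨fun σ τ h => ⟨h.1.symm, by rw [Set.inter_comm]; exact h.2⟩⟩
  loopless := ⟨fun _ h => h.1 rfl⟩

/-- Connected through codimension one (a connected graph is nonempty). -/
def ConnectedThroughCodimOne (S : Set (Set (ι → ℝ))) : Prop :=
  (facetRidgeGraph S).Connected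

/-- The cone of directions `v` in which one can move from `w` inside `σ`:
`w + ε v ∈ σ` for all sufficiently small `ε > 0`. -/
def coneAt (w : ι → ℝ) (σ : Set (ι → ℝ)) : Set (ι → ℝ) :=
  {v | ∀ᶠ ε in 𝓝[>] (0 : ℝ), w + ε • v ∈ σ}

/-- The star of `S` at `w`: the fan of the cones at `w` of all cells that contain `w`. -/
def starAt (S : Set (Set (ι → ℝ))) (w : ι → ℝ) : Set (Set (ι → ℝ)) :=
  coneAt w '' {σ ∈ S | w ∈ σ}

/-- Locally connected through codimension one. -/
def LocallyConnectedThroughCodimOne (S : Set (Set (ι → ℝ))) : Prop :=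
  ∀ w ∈ support S, ConnectedThroughCodimOne (starAt S w)

end Polyhedral

/-! ### Bergman fans and tropical manifolds -/

/-- The Bergman fan in `ℝ^m` of a matroid with ground set `Fin m`: on every circuit, the minimum of
the coordinates is attained at least twice. It is empty if the matroid has a loop. -/
def bergmanFan {m : ℕ} (M : Matroid (Fin m)) : Set (Fin m → ℝ) :=
  {x | ∀ C, M.IsCircuit C → ∃ i ∈ C, ∃ j ∈ C, i ≠ j ∧ x i = x j ∧ ∀ k ∈ C, x i ≤ x k}

/-- The line `ℝ·(1, …, 1)`, which always lies in the lineality space of a Bergman fan. -/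
def onesLine (m : ℕ) : Submodule ℝ (Fin m → ℝ) := Submodule.span ℝ {fun _ => 1}

/-- The image of the Bergman fan in `ℝ^m / ℝ·(1, …, 1)`. -/
def projBergmanFan {m : ℕ} (M : Matroid (Fin m)) : Set ((Fin m → ℝ) ⧸ onesLine m) :=
  (onesLine m).mkQ '' bergmanFan M

/-- Two subsets of real vector spaces are linearly isomorphic if a linear isomorphism between their
linear spans maps one onto the other. -/
def LinearlyIsomorphic {V W : Type*} [AddCommGroup V] [Module ℝ V] [AddCommGroup W] [Module ℝ W]
    (A : Set V) (B : Set W) : Prop :=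
  ∃ e : Submodule.span ℝ A ≃ₗ[ℝ] Submodule.span ℝ B,
    ∀ x : Submodule.span ℝ A, (e x : W) ∈ B ↔ (x : V) ∈ A

/-- A `d`-dimensional tropical manifold: a polyhedral complex whose star at every point of the
support is `d`-dimensional and is linearly isomorphic to the Bergman fan of a matroid. The fan may
be taken in `ℝ^m` or modulo `ℝ·(1, …, 1)`, and only the supports are compared, so that no particular
polyhedral structure on the Bergman fan is prescribed. -/
structure IsTropicalManifold {ι : Type*} (d : ℕ) (S : Set (Set (ι → ℝ))) : Prop where
  isPolyhedralComplex : IsPolyhedralComplex S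
  hasDim_star : ∀ w ∈ support S, HasDim (starAt S w) d
  star_iso : ∀ w ∈ support S, ∃ (m : ℕ) (M : Matroid (Fin m)), M.E = Set.univ ∧
    (LinearlyIsomorphic (support (starAt S w)) (bergmanFan M) ∨
      LinearlyIsomorphic (support (starAt S w)) (projBergmanFan M))

/-! ### Valuated matroids and tropical linear spaces -/

/-- The tropical semiring `ℝ ∪ {∞}` with `a ⊕ b = min a b` and `a ⊙ b = a + b`. Its zero is `∞`,
and its order is the order of `ℝ ∪ {∞}`. -/
abbrev TropNum : Type := Tropical (WithTop ℝ)

/-- A subsemimodule of `𝕋ⁿ` is (the set of vectors of) a valuated matroid if it satisfies the vector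
elimination axiom. Here `0` is `∞`, and `G i + H i` is the minimum of `G i` and `H i`. -/
def IsValuatedMatroid {n : ℕ} (V : Submodule TropNum (Fin n → TropNum)) : Prop :=
  ∀ G ∈ V, ∀ H ∈ V, ∀ e, G e = H e → ∃ F ∈ V, F e = 0 ∧
    ∀ i, i ≠ e → G i + H i ≤ F i ∧ (G i ≠ H i → F i = G i + H i)

/-- The tropical hypersurface in `𝕋ⁿ` of the linear form `⨁ᵢ vᵢ ⊙ xᵢ`: the points at which its value
is `∞` or is attained by at least two of the terms. -/
def tropHyperplane {n : ℕ} (v : Fin n → TropNum) : Set (Fin n → TropNum) :=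
  {x | ∑ i, v i * x i = 0 ∨
    ∃ i j, i ≠ j ∧ v i * x i = ∑ k, v k * x k ∧ v j * x j = ∑ k, v k * x k}

/-- The tropical linear space `trop(V) ⊆ 𝕋ⁿ`. -/
def tropLinearSpace {n : ℕ} (V : Submodule TropNum (Fin n → TropNum)) : Set (Fin n → TropNum) :=
  ⋂ v ∈ V, tropHyperplane v

/-- The coordinates that are `∞` on all of `trop(V)` (the loops of the valuated matroid). -/
def infiniteCoords {n : ℕ} (V : Submodule TropNum (Fin n → TropNum)) : Set (Fin n) :=
  {i | ∀ x ∈ tropLinearSpace V, x i = 0}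

open Classical in
/-- The part of `trop(V)` in which all other coordinates are finite, as a subset of a real
coordinate space. If `V` has no loops then this is `trop(V) ∩ ℝⁿ`. -/
noncomputable def finitePart {n : ℕ} (V : Submodule TropNum (Fin n → TropNum)) :
    Set ({i // i ∉ infiniteCoords V} → ℝ) :=
  {x | (fun i => if h : i ∈ infiniteCoords V then (0 : TropNum)
      else Tropical.trop ((x ⟨i, h⟩ : ℝ) : WithTop ℝ)) ∈ tropLinearSpace V}

end TropicalConnectivity

/-!
The fan with the points at which the minimum over every circuit of a matroid is attained twice is
treated through a statement that does not mention polyhedral structures: if the matroid has rank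
`d`, then removing finitely many subspaces of dimension less than `d` leaves a dense part of the
fan, and removing finitely many subspaces of dimension at most `d - 2` leaves a connected part
(`IsElimFamily.dense_and_preconnected`). The proof is by induction on the number of elements that
are not coloops. For an element `e` on a circuit, the fan is a tropical modification: the graph of
a continuous function over the fan of the deletion of `e`, together with the part above the graph
of the cylinder over the fan of the contraction of `e` (`IsElimFamily.exists_isModification`). The
graph part is connected by induction, after cylinders in the direction `e` over the removed
subspaces have been removed. Any other point is moved off these cylinders by a short tropical
segment, which stays in the fan because the fan is tropically convex, and then vertically down to
the graph (`IsModification.preconnectedOffSubspaces`).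

Both properties pass to linear images (`isConnectedFan_of_linearlyIsomorphic`), and they determine
the combinatorics of every polyhedral complex whose support is such a fan. The facets have
dimension `d` and cover, and away from the cones of codimension at least two, two facets that share
a point intersect in a ridge. Hence the stars of a tropical manifold are connected through
codimension one (`connectedThroughCodimOne_starAt`). To pass from the stars to the whole complex,
note that paths of facets in the star at `w` lift to paths of facets through `w`, so that the
class of the facets through a point, under reachability in the facet-ridge graph, is a locally
constant function on the connected support (`connectedThroughCodimOne_of_locally`).

For a valuated matroid and a point `w` of its tropical linear space, vector elimination makes the
initial forms at `w` of the vectors a family of sets with strong circuit elimination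
(`IsVectorFamily.isElimFamily`). The minimal members are the circuits of a matroid, and the star at
`w` is its Bergman fan (`IsVectorFamily.coneAt_tropSet`). Finitely many vectors of minimal support
cut out the tropical linear space, so that it is a union of cells of a hyperplane arrangement
(`IsVectorFamily.exists_isPolyhedralComplex`). It is connected by tropical convexity, and
since the dimension of the star is constant on every cell, it is constant on the whole space.
-/

namespace TropicalConnectivity

/-! ### Elimination families and their matroids -/

section ElimFamily

variable {α : Type*}

/-- A family of nonempty sets with strong circuit elimination. The circuits of a matroid form such
a family, and so do the initial forms of the vectors of a valuated matroid. Unlike circuits, the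
members need not be minimal, which makes the notion stable under deletion and contraction without
passing to minimal members. -/
structure IsElimFamily (F : Set (Set α)) : Prop where
  nonempty : ∀ S ∈ F, S.Nonempty
  elim : ∀ S ∈ F, ∀ T ∈ F, ∀ e ∈ S, e ∈ T → ∀ f ∈ S, f ∉ T → ∃ U ∈ F, f ∈ U ∧ U ⊆ S ∪ T ∧ e ∉ U

/-- The minimum of the coordinates `x i`, `i ∈ S`, is attained at least twice. -/
def AttainedTwice (x : α → ℝ) (S : Set α) : Prop :=
  ∃ i ∈ S, ∃ j ∈ S, i ≠ j ∧ x i = x j ∧ ∀ k ∈ S, x i ≤ x k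

/-- The points at which the minimum over every member of the family is attained twice. For the
circuits of a matroid this is the Bergman fan. -/
def fanOf (F : Set (Set α)) : Set (α → ℝ) := {x | ∀ S ∈ F, AttainedTwice x S}

/-- The sets of the family that avoid `e`. All families live on the same ground type, so that `e`
becomes a coloop rather than disappears. -/
def deleteElt (F : Set (Set α)) (e : α) : Set (Set α) := {S | S ∈ F ∧ e ∉ S}

/-- The nonempty sets `S \ {e}`, for `S` in the family. Again `e` becomes a coloop. -/
def contractElt (F : Set (Set α)) (e : α) : Set (Set α) :=
  {S | S.Nonempty ∧ ∃ T ∈ F, S = T \ {e}}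

theorem IsElimFamily.deleteElt {F : Set (Set α)} (hF : IsElimFamily F) (e : α) :
    IsElimFamily (deleteElt F e) where
  nonempty S hS := hF.nonempty S hS.1
  elim S hS T hT a ha ha' f hf hf' := by
    obtain ⟨U, hU, hfU, hsub, haU⟩ := hF.elim S hS.1 T hT.1 a ha ha' f hf hf'
    exact ⟨U, ⟨hU, fun h => (hsub h).elim hS.2 hT.2⟩, hfU, hsub, haU⟩

theorem IsElimFamily.contractElt {F : Set (Set α)} (hF : IsElimFamily F) (e : α) :
    IsElimFamily (contractElt F e) where
  nonempty S hS := hS.1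
  elim := by
    rintro _ ⟨-, S, hS, rfl⟩ _ ⟨-, T, hT, rfl⟩ a ha ha' f hf hf'
    obtain ⟨U, hU, hfU, hsub, haU⟩ := hF.elim S hS T hT a ha.1 ha'.1 f hf.1
      (fun h => hf' ⟨h, hf.2⟩)
    refine ⟨U \ {e}, ⟨⟨f, hfU, hf.2⟩, U, hU, rfl⟩, ⟨hfU, hf.2⟩, ?_, fun h => haU h.1⟩
    rintro x ⟨hx, hxe⟩
    exact (hsub hx).imp (fun h => ⟨h, hxe⟩) (fun h => ⟨h, hxe⟩)

theorem isElimFamily_isCircuit (M : Matroid α) : IsElimFamily {C | M.IsCircuit C} where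
  nonempty _ hS := Matroid.IsCircuit.nonempty hS
  elim S hS T hT e he he' f hf hf' := by
    obtain ⟨C, hC, hCc, hfC⟩ := Matroid.IsCircuit.strong_elimination hS hT he he' hf hf'
    exact ⟨C, hCc, hfC, fun x hx => (hC hx).1, fun h => (hC h).2 rfl⟩

/-- A set is independent if it contains no member of the family. -/
def FamilyIndep (F : Set (Set α)) (I : Set α) : Prop := ∀ S ∈ F, ¬ S ⊆ I

theorem FamilyIndep.subset {F : Set (Set α)} {I J : Set α} (hJ : FamilyIndep F J) (h : I ⊆ J) :
    FamilyIndep F I := fun S hS hSI => hJ S hS (hSI.trans h)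

/-- Idempotence of the closure operator: if every element of `B \ I` is spanned by `I` and `y` is
spanned by `B`, then `y` is spanned by `I`. -/
theorem IsElimFamily.exists_subset_insert [Finite α] {F : Set (Set α)} (hF : IsElimFamily F)
    {I B : Set α} (hI : ∀ x ∈ B \ I, ∃ T ∈ F, x ∈ T ∧ T ⊆ insert x I) {y : α} (hyI : y ∉ I)
    {S : Set α} (hS : S ∈ F) (hyS : y ∈ S) (hSB : S \ insert y I ⊆ B) :
    ∃ U ∈ F, y ∈ U ∧ U ⊆ insert y I := by
  induction h : (S \ insert y I).ncard using Nat.strong_induction_on generalizing S with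
  | _ n ih =>
  by_cases hsub : S ⊆ insert y I
  · exact ⟨S, hS, hyS, hsub⟩
  obtain ⟨x, hxS, hxI⟩ := Set.not_subset.1 hsub
  have hxy : x ≠ y := fun h => hxI (h ▸ Set.mem_insert _ _)
  have hxI' : x ∉ I := fun h => hxI (Set.mem_insert_of_mem _ h)
  obtain ⟨T, hT, hxT, hTI⟩ := hI x ⟨hSB ⟨hxS, hxI⟩, hxI'⟩
  have hyT : y ∉ T := fun h => (hTI h).elim (fun h => hxy h.symm) hyI
  obtain ⟨U, hU, hyU, hUsub, hxU⟩ := hF.elim S hS T hT x hxS hxT y hyS hyT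
  have hUsub' : U \ insert y I ⊆ S \ insert y I := by
    rintro z ⟨hz, hzI⟩
    refine ⟨(hUsub hz).elim id fun hzT => ?_, hzI⟩
    rcases hTI hzT with rfl | hz'
    · exact hxS
    · exact absurd (Set.mem_insert_of_mem _ hz') hzI
  refine ih _ ?_ hU hyU (hUsub'.trans hSB) rfl
  rw [← h]
  exact Set.ncard_lt_ncard ⟨hUsub', fun hh => hxU (hh ⟨hxS, hxI⟩).1⟩ (Set.toFinite _)

/-- The matroid on the whole ground type whose dependent sets are the sets that contain a member of
the family. -/
def IsElimFamily.matroid [Finite α] {F : Set (Set α)} (hF : IsElimFamily F) : Matroid α :=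
  IndepMatroid.matroid
  { E := Set.univ
    Indep := FamilyIndep F
    indep_empty := fun S hS h => (hF.nonempty S hS).ne_empty (Set.subset_empty_iff.1 h)
    indep_subset := fun _ _ hJ h => hJ.subset h
    indep_aug := by
      intro I B hI hImax hB
      by_contra! hcon
      have hsp : ∀ x ∉ I, ¬ FamilyIndep F (insert x I) → ∃ T ∈ F, x ∈ T ∧ T ⊆ insert x I := by
        intro x _ hdep
        simp only [FamilyIndep, not_forall, not_not] at hdep
        obtain ⟨T, hT, hTI⟩ := hdep
        refine ⟨T, hT, by_contra fun hxT => hI T hT fun z hz => ?_, hTI⟩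
        exact (hTI hz).resolve_left fun h => hxT (h ▸ hz)
      have hBI : ∀ x ∈ B \ I, ∃ T ∈ F, x ∈ T ∧ T ⊆ insert x I :=
        fun x hx => hsp x hx.2 (hcon x hx)
      obtain ⟨y, hyI, hy⟩ : ∃ y ∉ I, FamilyIndep F (insert y I) := by
        by_contra! hno
        refine hImax ⟨hI, fun J hJ hIJ z hz => by_contra fun hzI => ?_⟩
        exact hno z hzI (hJ.subset (Set.insert_subset hz hIJ))
      have hyB : y ∉ B := fun h => hcon y ⟨h, hyI⟩ hy
      have hyB' : ¬ FamilyIndep F (insert y B) := fun h =>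
        hyB (hB.2 h (Set.subset_insert _ _) (Set.mem_insert _ _))
      simp only [FamilyIndep, not_forall, not_not] at hyB'
      obtain ⟨S, hS, hSB⟩ := hyB'
      have hyS : y ∈ S := by_contra fun h => hB.1 S hS fun z hz =>
        (hSB hz).resolve_left fun h' => h (h' ▸ hz)
      obtain ⟨U, hU, -, hUI⟩ := hF.exists_subset_insert hBI hyI hS hyS
        (fun z hz => (hSB hz.1).resolve_left fun h => hz.2 (h ▸ Set.mem_insert _ _))
      exact hy U hU hUI
    indep_maximal := by
      intro X _ I hI hIX
      obtain ⟨J, hIJ, hJ⟩ := (Set.toFinite {J | FamilyIndep F J ∧ J ⊆ X}).exists_le_maximal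
        (a := I) ⟨hI, hIX⟩
      exact ⟨J, hIJ, hJ⟩
    subset_ground := fun _ _ => Set.subset_univ _ }

theorem IsElimFamily.matroid_E [Finite α] {F : Set (Set α)} (hF : IsElimFamily F)
    : hF.matroid.E = Set.univ := rfl

theorem IsElimFamily.matroid_indep [Finite α] {F : Set (Set α)} (hF : IsElimFamily F)
    {I : Set α} : hF.matroid.Indep I ↔ FamilyIndep F I := Iff.rfl

theorem IsElimFamily.matroid_isBase [Finite α] {F : Set (Set α)} (hF : IsElimFamily F) {B : Set α} :
    hF.matroid.IsBase B ↔ Maximal (FamilyIndep F) B := Iff.rfl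

theorem IsElimFamily.matroid_isCircuit [Finite α] {F : Set (Set α)} (hF : IsElimFamily F)
    {C : Set α} :
    hF.matroid.IsCircuit C ↔ Minimal (· ∈ F) C := by
  rw [Matroid.isCircuit_iff_minimal_not_indep (by rw [hF.matroid_E]; exact Set.subset_univ _)]
  have hdep : ∀ X, ¬ hF.matroid.Indep X ↔ ∃ S ∈ F, S ⊆ X := by
    intro X; simp [hF.matroid_indep, FamilyIndep]
  simp only [hdep]
  constructor
  · rintro ⟨⟨S, hS, hSC⟩, hmin⟩
    have : S = C := hSC.antisymm (hmin ⟨S, hS, subset_rfl⟩ hSC)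
    subst this
    exact ⟨hS, fun T hT hTS => hmin ⟨T, hT, subset_rfl⟩ hTS⟩
  · rintro ⟨hC, hmin⟩
    refine ⟨⟨C, hC, subset_rfl⟩, ?_⟩
    rintro X ⟨S, hS, hSX⟩ hXC
    exact (hmin hS (hSX.trans hXC)).trans hSX

/-- Every element of a member of the family lies in a minimal member inside it. -/
theorem IsElimFamily.exists_minimal [Finite α] {F : Set (Set α)} (hF : IsElimFamily F)
    {S : Set α} (hS : S ∈ F) {e : α} (he : e ∈ S) :
    ∃ C, Minimal (· ∈ F) C ∧ C ⊆ S ∧ e ∈ C := by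
  induction h : S.ncard using Nat.strong_induction_on generalizing S with
  | _ n ih =>
  subst h
  by_cases hmin : Minimal (· ∈ F) S
  · exact ⟨S, hmin, subset_rfl, he⟩
  obtain ⟨T, hTS, hT⟩ : ∃ T, T ⊂ S ∧ T ∈ F := by
    simpa [minimal_iff_forall_lt, hS] using hmin
  suffices ∃ U ∈ F, U ⊂ S ∧ e ∈ U by
    obtain ⟨U, hU, hUS, heU⟩ := this
    obtain ⟨C, hC, hCU, heC⟩ := ih _ (Set.ncard_lt_ncard hUS (Set.toFinite _)) hU heU rfl
    exact ⟨C, hC, hCU.trans hUS.subset, heC⟩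
  by_cases heT : e ∈ T
  · exact ⟨T, hT, hTS, heT⟩
  obtain ⟨f, hf⟩ := hF.nonempty T hT
  obtain ⟨U, hU, heU, hUsub, hfU⟩ := hF.elim S hS T hT f (hTS.subset hf) hf e he heT
  rw [Set.union_eq_left.2 hTS.subset] at hUsub
  exact ⟨U, hU, ⟨hUsub, fun h => hfU (h (hTS.subset hf))⟩, heU⟩

/-- The Bergman fan of the matroid of an elimination family is the fan of the family. -/
theorem IsElimFamily.fanOf_isCircuit [Finite α] {F : Set (Set α)} (hF : IsElimFamily F) :
    fanOf {C | hF.matroid.IsCircuit C} = fanOf F := by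
  ext x
  constructor
  · intro hx S hS
    -- a coordinate minimal on `S`, in a circuit inside `S`
    obtain ⟨e, he, hmin⟩ := Set.exists_min_image S x (Set.toFinite _) (hF.nonempty S hS)
    obtain ⟨C, hC, hCS, heC⟩ := hF.exists_minimal hS he
    obtain ⟨i, hi, j, hj, hij, hxij, hle⟩ := hx C (hF.matroid_isCircuit.2 hC)
    exact ⟨i, hCS hi, j, hCS hj, hij, hxij, fun k hk => (hle e heC).trans (hmin k hk)⟩
  · intro hx C hC
    exact hx C (hF.matroid_isCircuit.1 hC).1

/-- Deleting an element that is not a coloop makes it a coloop and so raises the rank by one. -/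
theorem IsElimFamily.exists_isBase_deleteElt [Finite α] {F : Set (Set α)} (hF : IsElimFamily F)
    {S : Set α} (hS : S ∈ F) {e : α} (he : e ∈ S) :
    ∃ B, hF.matroid.IsBase B ∧ e ∉ B ∧ (hF.deleteElt e).matroid.IsBase (insert e B) := by
  obtain ⟨C, hC, -, heC⟩ := hF.exists_minimal hS he
  have hCind : hF.matroid.Indep (C \ {e}) :=
    (hF.matroid_isCircuit.2 hC).sdiff_singleton_indep heC
  obtain ⟨B, hB, hCB⟩ := hCind.exists_isBase_superset
  have hB' := hF.matroid_isBase.1 hB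
  have heB : e ∉ B := by
    intro heB
    refine hB'.1 C hC.1 fun z hz => ?_
    by_cases hze : z = e
    · exact hze ▸ heB
    · exact hCB ⟨hz, hze⟩
  refine ⟨B, hB, heB, (hF.deleteElt e).matroid_isBase.2 ⟨fun T hT hTB => ?_, ?_⟩⟩
  · exact hB'.1 T hT.1 fun z hz => (hTB hz).resolve_left fun h => hT.2 (h ▸ hz)
  · intro J hJ hBJ z hz
    by_contra hzB
    have hzB' : ¬ FamilyIndep F (insert z B) := fun h =>
      hzB (Set.mem_insert_of_mem _ (hB'.2 h (Set.subset_insert _ _) (Set.mem_insert _ _)))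
    simp only [FamilyIndep, not_forall, not_not] at hzB'
    obtain ⟨T, hT, hTB⟩ := hzB'
    have heT : e ∉ T := fun h => (hTB h).elim (fun h => hzB (h ▸ Set.mem_insert _ _)) heB
    refine hJ T ⟨hT, heT⟩ fun y hy => ?_
    rcases hTB hy with rfl | h
    · exact hz
    · exact hBJ (Set.mem_insert_of_mem _ h)

/-- Contracting an element that is not a loop makes it a coloop and so keeps the rank. -/
theorem IsElimFamily.exists_isBase_contractElt [Finite α] {F : Set (Set α)} (hF : IsElimFamily F)
    {e : α} (he : {e} ∉ F) :
    ∃ B, hF.matroid.IsBase B ∧ (hF.contractElt e).matroid.IsBase B := by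
  have hind : hF.matroid.Indep {e} := by
    refine hF.matroid_indep.2 fun S hS hSe => ?_
    rcases Set.subset_singleton_iff_eq.1 hSe with rfl | rfl
    · exact (hF.nonempty _ hS).ne_empty rfl
    · exact he hS
  obtain ⟨B, hB, heB⟩ := hind.exists_isBase_superset
  have hB' := hF.matroid_isBase.1 hB
  rw [Set.singleton_subset_iff] at heB
  refine ⟨B, hB, (hF.contractElt e).matroid_isBase.2 ⟨?_, ?_⟩⟩
  · rintro _ ⟨-, T, hT, rfl⟩ hTB
    refine hB'.1 T hT fun z hz => ?_
    by_cases hze : z = e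
    · exact hze ▸ heB
    · exact hTB ⟨hz, hze⟩
  · intro J hJ hBJ z hz
    by_contra hzB
    have hzB' : ¬ FamilyIndep F (insert z B) := fun h =>
      hzB (hB'.2 h (Set.subset_insert _ _) (Set.mem_insert _ _))
    simp only [FamilyIndep, not_forall, not_not] at hzB'
    obtain ⟨T, hT, hTB⟩ := hzB'
    have hzT : z ∈ T := by_contra fun h => hB'.1 T hT fun y hy =>
      (hTB hy).resolve_left fun h' => h (h' ▸ hy)
    refine hJ (T \ {e}) ⟨⟨z, hzT, fun h => hzB (h ▸ heB)⟩, T, hT, rfl⟩ fun y hy => ?_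
    rcases hTB hy.1 with rfl | h
    · exact hz
    · exact hBJ h

/-- If `x` lies in the fan and is injective on `I`, then `I` is independent: on a circuit inside `I`
the minimum would be attained only once. -/
theorem familyIndep_of_injOn {F : Set (Set α)} {x : α → ℝ} (hx : x ∈ fanOf F) {I : Set α}
    (hI : Set.InjOn x I) : FamilyIndep F I := by
  intro S hS hSI
  obtain ⟨i, hi, j, hj, hij, hxij, -⟩ := hx S hS
  exact hij (hI (hSI hi) (hSI hj) hxij)

end ElimFamily

/-! ### Removing subspaces from sets -/

section Subspaces

variable {E : Type*} [AddCommGroup E] [Module ℝ E]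

/-- The union of a set of subspaces. -/
def unionOf (Z : Set (Submodule ℝ E)) : Set E := ⋃ W ∈ Z, (W : Set E)

theorem mem_unionOf {Z : Set (Submodule ℝ E)} {x : E} : x ∈ unionOf Z ↔ ∃ W ∈ Z, x ∈ W := by
  simp [unionOf]

/-- A convex set covered by finitely many subspaces lies in one of them. -/
theorem exists_subset_of_convex_of_subset_unionOf {A : Set E} (hA : Convex ℝ A)
    (hne : A.Nonempty) {Z : Set (Submodule ℝ E)} (hZ : Z.Finite) (h : A ⊆ unionOf Z) :
    ∃ W ∈ Z, A ⊆ W := by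
  induction Z, hZ using Set.Finite.induction_on with
  | empty =>
    obtain ⟨a, ha⟩ := hne
    simpa [unionOf] using h ha
  | @insert W₀ Z _ hZ ih =>
    by_cases h₀ : A ⊆ W₀
    · exact ⟨W₀, Set.mem_insert _ _, h₀⟩
    by_cases h₁ : A ⊆ unionOf Z
    · obtain ⟨W, hW, hAW⟩ := ih h₁
      exact ⟨W, Set.mem_insert_of_mem _ hW, hAW⟩
    exfalso
    obtain ⟨a, ha, ha₀⟩ := Set.not_subset.1 h₀
    obtain ⟨b, hb, hb₁⟩ := Set.not_subset.1 h₁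
    -- each of the subspaces misses `a` or `b`, so it meets the segment from `a` to `b` at most once
    have hsub : Set.Icc (0 : ℝ) 1 ⊆ ⋃ W ∈ insert W₀ Z, {t : ℝ | a + t • (b - a) ∈ W} := by
      intro t ht
      obtain ⟨W, hW, hmem⟩ := mem_unionOf.1 (h (hA.add_smul_sub_mem ha hb ht))
      exact Set.mem_biUnion hW hmem
    refine Set.Icc_infinite (zero_lt_one' ℝ) (((hZ.insert W₀).biUnion fun W hW => ?_).subset hsub)
    refine Set.Subsingleton.finite fun s hs t ht => by_contra fun hst => ?_
    have hba : b - a ∈ W := by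
      have := W.sub_mem hs ht
      rw [add_sub_add_left_eq_sub, ← sub_smul] at this
      exact (W.smul_mem_iff (sub_ne_zero.2 hst)).1 this
    have haW : a ∈ W := by
      have := W.sub_mem hs (W.smul_mem s hba)
      rwa [add_sub_cancel_right] at this
    have hbW : b ∈ W := by simpa using W.add_mem haW hba
    rcases hW with rfl | hW
    · exact ha₀ haW
    · exact hb₁ (mem_unionOf.2 ⟨W, hW, hbW⟩)

theorem isClosed_unionOf [TopologicalSpace E] [IsTopologicalAddGroup E] [ContinuousSMul ℝ E]
    [T2Space E] [FiniteDimensional ℝ E] {Z : Set (Submodule ℝ E)} (hZ : Z.Finite) :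
    IsClosed (unionOf Z) :=
  hZ.isClosed_biUnion fun W _ => W.closed_of_finiteDimensional

/-- Removing finitely many subspaces of dimension less than `d` leaves a dense part of `X`. In this
sense, the local dimension of `X` is everywhere at least `d`. -/
def DenseOffSubspaces [TopologicalSpace E] (d : ℕ) (X : Set E) : Prop :=
  ∀ Z : Set (Submodule ℝ E), Z.Finite → (∀ W ∈ Z, Module.finrank ℝ W < d) →
    X ⊆ closure (X \ unionOf Z)

/-- Removing finitely many subspaces of dimension at most `d - 2` leaves `X` preconnected: a form of
connectedness through codimension one that does not refer to a polyhedral structure. -/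
def PreconnectedOffSubspaces [TopologicalSpace E] (d : ℕ) (X : Set E) : Prop :=
  ∀ Z : Set (Submodule ℝ E), Z.Finite → (∀ W ∈ Z, Module.finrank ℝ W + 2 ≤ d) →
    IsPreconnected (X \ unionOf Z)

theorem finrank_sup_span_singleton_le [FiniteDimensional ℝ E] (W : Submodule ℝ E) (v : E) :
    Module.finrank ℝ (W ⊔ Submodule.span ℝ {v} : Submodule ℝ E) ≤ Module.finrank ℝ W + 1 := by
  refine (Submodule.finrank_add_le_finrank_add_finrank _ _).trans ?_
  gcongr
  simpa using finrank_span_le_card (R := ℝ) ({v} : Set E)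

theorem not_univ_subset_unionOf [FiniteDimensional ℝ E] {Z : Set (Submodule ℝ E)} (hZ : Z.Finite)
    (h : ∀ W ∈ Z, Module.finrank ℝ W < Module.finrank ℝ E) : ¬ Set.univ ⊆ unionOf Z := by
  intro hsub
  obtain ⟨W, hW, hWu⟩ :=
    exists_subset_of_convex_of_subset_unionOf convex_univ Set.univ_nonempty hZ hsub
  have : W = ⊤ := Submodule.eq_top_iff'.2 fun x => hWu (Set.mem_univ x)
  subst this
  exact absurd (h _ hW) (by simp)

end Subspaces

section Normed

variable {E : Type*} [NormedAddCommGroup E] [NormedSpace ℝ E]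

theorem denseOffSubspaces_univ : DenseOffSubspaces (Module.finrank ℝ E) (Set.univ : Set E) := by
  intro Z hZ hd x _
  rw [Metric.mem_closure_iff]
  intro ε hε
  by_contra! hcon
  have hsub : Metric.ball x ε ⊆ unionOf Z := fun y hy => by_contra fun hyZ =>
    absurd (hcon y ⟨Set.mem_univ _, hyZ⟩) (by rw [dist_comm]; exact not_le.2 hy)
  obtain ⟨W, hW, hWb⟩ := exists_subset_of_convex_of_subset_unionOf (convex_ball x ε)
    ⟨x, Metric.mem_ball_self hε⟩ hZ hsub
  have hint : (interior (W : Set E)).Nonempty :=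
    ⟨x, mem_interior.2 ⟨_, hWb, Metric.isOpen_ball, Metric.mem_ball_self hε⟩⟩
  have := hd W hW
  rw [Submodule.eq_top_of_nonempty_interior' W hint] at this
  simp at this

theorem preconnectedOffSubspaces_univ [FiniteDimensional ℝ E] :
    PreconnectedOffSubspaces (Module.finrank ℝ E) (Set.univ : Set E) := by
  intro Z hZ hd
  refine isPreconnected_of_forall_pair fun x hx y hy => ?_
  -- a point `z` that lies on no line through `x` or `y` and one of the removed subspaces
  obtain ⟨z, -, hz⟩ := Set.not_subset.1 (not_univ_subset_unionOf (E := E)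
    (Z := (fun W => W ⊔ Submodule.span ℝ {x}) '' Z ∪ (fun W => W ⊔ Submodule.span ℝ {y}) '' Z)
    ((hZ.image _).union (hZ.image _)) (by
      rintro _ (⟨W, hW, rfl⟩ | ⟨W, hW, rfl⟩)
      · have := finrank_sup_span_singleton_le W x
        have := hd W hW
        dsimp only; omega
      · have := finrank_sup_span_singleton_le W y
        have := hd W hW
        dsimp only; omega))
  have key : ∀ p, p ∉ unionOf Z → (∀ W ∈ Z, z ∉ W ⊔ Submodule.span ℝ {p}) →
      segment ℝ p z ⊆ Set.univ \ unionOf Z := by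
    intro p hp hpz q hq
    refine ⟨Set.mem_univ _, fun hqZ => ?_⟩
    obtain ⟨W, hW, hqW⟩ := mem_unionOf.1 hqZ
    obtain ⟨a, b, -, -, hab, rfl⟩ := hq
    by_cases hb : b = 0
    · have ha : a = 1 := by linarith
      simp only [hb, ha, one_smul, zero_smul, add_zero] at hqW
      exact hp (mem_unionOf.2 ⟨W, hW, hqW⟩)
    · apply hpz W hW
      have h1 : b • z ∈ W ⊔ Submodule.span ℝ {p} := by
        have := Submodule.sub_mem (W ⊔ Submodule.span ℝ {p}) (Submodule.mem_sup_left hqW)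
          (Submodule.mem_sup_right (Submodule.smul_mem _ a (Submodule.mem_span_singleton_self p)))
        rwa [add_sub_cancel_left] at this
      exact (Submodule.smul_mem_iff _ hb).1 h1
  refine ⟨segment ℝ x z ∪ segment ℝ y z, Set.union_subset (key x hx.2 fun W hW h => hz ?_)
    (key y hy.2 fun W hW h => hz ?_), Or.inl (left_mem_segment _ _ _),
    Or.inr (left_mem_segment _ _ _), IsPreconnected.union z (right_mem_segment _ _ _)
      (right_mem_segment _ _ _) (convex_segment _ _).isPreconnected
      (convex_segment _ _).isPreconnected⟩
  · exact mem_unionOf.2 ⟨_, Or.inl ⟨W, hW, rfl⟩, h⟩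
  · exact mem_unionOf.2 ⟨_, Or.inr ⟨W, hW, rfl⟩, h⟩

end Normed

/-! ### Tropical convexity -/

section Convexity

variable {α : Type*} {F : Set (Set α)}

theorem min_add_mem_fanOf {x y : α → ℝ} (hx : x ∈ fanOf F) (hy : y ∈ fanOf F) (s t : ℝ) :
    (fun i => min (x i + s) (y i + t)) ∈ fanOf F := by
  intro S hS
  obtain ⟨i, hi, j, hj, hij, hxij, hxle⟩ := hx S hS
  obtain ⟨k, hk, l, hl, hkl, hykl, hyle⟩ := hy S hS
  rcases le_total (x i + s) (y k + t) with h | h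
  · refine ⟨i, hi, j, hj, hij, ?_, fun m hm => ?_⟩
    · dsimp only
      rw [min_eq_left (h.trans (by linarith [hyle i hi])), min_eq_left (by linarith [hyle j hj]),
        hxij]
    · exact (min_le_left _ _).trans (le_min (by linarith [hxle m hm]) (by linarith [hyle m hm]))
  · refine ⟨k, hk, l, hl, hkl, ?_, fun m hm => ?_⟩
    · dsimp only
      rw [min_eq_right (h.trans (by linarith [hxle k hk])), min_eq_right (by linarith [hxle l hl]),
        hykl]
    · exact (min_le_right _ _).trans (le_min (by linarith [hxle m hm]) (by linarith [hyle m hm]))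

/-- Two points of a tropically convex set are joined by a tropical segment, which stays as close to
the first point as the second point is. -/
theorem exists_tropical_path [Fintype α] {X : Set (α → ℝ)}
    (hX : ∀ x ∈ X, ∀ y ∈ X, ∀ s t : ℝ, (fun i => min (x i + s) (y i + t)) ∈ X)
    {x y : α → ℝ} (hx : x ∈ X) (hy : y ∈ X) :
    ∃ T ⊆ X, T ⊆ Metric.closedBall x (dist x y) ∧ x ∈ T ∧ y ∈ T ∧ IsPreconnected T := by
  set c := dist x y with hc
  have hc0 : 0 ≤ c := dist_nonneg
  have hxy : ∀ i, |x i - y i| ≤ c := fun i => by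
    rw [← Real.dist_eq]; exact dist_le_pi_dist x y i
  refine ⟨(fun s : ℝ => fun i => min (x i + s) (y i + (c - s))) '' Set.Icc 0 c, ?_, ?_,
    ⟨0, ⟨le_rfl, hc0⟩, ?_⟩, ⟨c, ⟨hc0, le_rfl⟩, ?_⟩,
    isPreconnected_Icc.image _ (Continuous.continuousOn (by fun_prop))⟩
  · rintro _ ⟨s, -, rfl⟩
    exact hX x hx y hy _ _
  · rintro _ ⟨s, hs, rfl⟩
    rw [Metric.mem_closedBall, dist_pi_le_iff hc0]
    intro i
    have := abs_le.1 (hxy i)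
    rw [Real.dist_eq, abs_le]
    constructor
    · have : x i - c ≤ min (x i + s) (y i + (c - s)) :=
        le_min (by linarith [hs.1]) (by linarith [hs.2])
      linarith
    · linarith [min_le_left (x i + s) (y i + (c - s)), hs.2]
  · funext i
    have := abs_le.1 (hxy i)
    simp only [add_zero, sub_zero]
    exact min_eq_left (by linarith)
  · funext i
    have := abs_le.1 (hxy i)
    simp only [sub_self, add_zero]
    exact min_eq_right (by linarith)

end Convexity

/-! ### Tropical modifications -/

section Modification

variable {α : Type*} {F : Set (Set α)}

/-- The function `x ↦ max_S min_{i ∈ S, i ≠ e} x i`, over the members `S ∋ e` of the family. The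
fan of the family is obtained from the graph of this function over the fan of the deletion by adding
the part above the graph of the fan of the contraction. -/
theorem exists_modification_function [Finite α] [DecidableEq α] {e : α}
    {S₀ : Set α} (hS₀ : S₀ ∈ F) (heS₀ : e ∈ S₀) (hne : {e} ∉ F) :
    ∃ f : (α → ℝ) → ℝ, Continuous f ∧ (∀ x t, f (Function.update x e t) = f x) ∧
      (∀ x, ∀ S ∈ F, e ∈ S → ∃ i ∈ S, i ≠ e ∧ x i ≤ f x) ∧
      (∀ x, ∃ T ∈ F, e ∈ T ∧ ∀ i ∈ T, i ≠ e → f x ≤ x i) := by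
  classical
  have := Fintype.ofFinite α
  set 𝒜 : Finset (Finset α) :=
    Finset.univ.filter (fun A => ∃ S ∈ F, e ∈ S ∧ (A : Set α) = S \ {e}) with h𝒜
  have hA : ∀ A ∈ 𝒜, A.Nonempty := by
    intro A hA
    obtain ⟨S, hS, heS, hAS⟩ := (Finset.mem_filter.1 hA).2
    rw [Finset.nonempty_iff_ne_empty]
    rintro rfl
    rw [Finset.coe_empty, eq_comm, Set.sdiff_eq_empty] at hAS
    exact hne (by rwa [← hAS.antisymm (Set.singleton_subset_iff.2 heS)])
  have hmem : ∀ S ∈ F, e ∈ S → (S \ {e}).toFinset ∈ 𝒜 := fun S hS heS =>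
    Finset.mem_filter.2 ⟨Finset.mem_univ _, S, hS, heS, by simp⟩
  have h𝒜ne : 𝒜.Nonempty := ⟨_, hmem S₀ hS₀ heS₀⟩
  let g : Finset α → (α → ℝ) → ℝ := fun A x => if h : A.Nonempty then A.inf' h x else 0
  have hg : ∀ A ∈ 𝒜, ∀ x, ∃ i ∈ A, g A x = x i ∧ ∀ j ∈ A, g A x ≤ x j := by
    intro A hA' x
    have h := hA A hA'
    obtain ⟨i, hi, hxi⟩ := Finset.exists_mem_eq_inf' h x
    refine ⟨i, hi, ?_, fun j hj => ?_⟩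
    · simp only [g, h, dif_pos, hxi]
    · simp only [g, h, dif_pos]
      exact Finset.inf'_le _ hj
  have hgc : ∀ A, Continuous (g A) := by
    intro A
    by_cases h : A.Nonempty
    · simp only [g, h, dif_pos]
      exact Continuous.finset_inf'_apply h fun i _ => continuous_apply i
    · simp only [g, h, dif_neg, not_false_eq_true]
      exact continuous_const
  refine ⟨fun x => 𝒜.sup' h𝒜ne fun A => g A x,
    Continuous.finset_sup'_apply h𝒜ne fun A _ => hgc A, fun x t => ?_, fun x S hS heS => ?_,
    fun x => ?_⟩
  · refine Finset.sup'_congr _ rfl fun A hA' => ?_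
    have heA : e ∉ A := by
      obtain ⟨S, hS, heS, hAS⟩ := (Finset.mem_filter.1 hA').2
      intro h
      have : e ∈ (A : Set α) := h
      rw [hAS] at this
      exact this.2 rfl
    have h := hA A hA'
    simp only [g, h, dif_pos]
    refine Finset.inf'_congr _ rfl fun i hi => ?_
    exact Function.update_of_ne (ne_of_mem_of_not_mem hi heA) _ _
  · obtain ⟨i, hi, hxi, -⟩ := hg _ (hmem S hS heS) x
    have hi' : i ∈ S \ {e} := by simpa using hi
    refine ⟨i, hi'.1, hi'.2, hxi ▸ ?_⟩
    exact Finset.le_sup' (fun A => g A x) (hmem S hS heS)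
  · obtain ⟨A, hA', hxA⟩ := Finset.exists_mem_eq_sup' h𝒜ne (fun A => g A x)
    obtain ⟨S, hS, heS, hAS⟩ := (Finset.mem_filter.1 hA').2
    refine ⟨S, hS, heS, fun i hi hie => ?_⟩
    obtain ⟨-, -, -, hle⟩ := hg A hA' x
    have hiA : i ∈ (A : Set α) := by rw [hAS]; exact ⟨hi, hie⟩
    exact hxA.le.trans (hle i hiA)

/-- A set `X` is the tropical modification, in the direction of the coordinate `e`, of `X'` along
`X''` with respect to `f`: the union of the graph of `f` over `X'` and of the part of the cylinder
`X''` above the graph. The sets `X'` and `X''` are cylinders, and `f` ignores the coordinate `e`. -/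
structure IsModification [DecidableEq α] (e : α) (f : (α → ℝ) → ℝ) (X X' X'' : Set (α → ℝ)) :
    Prop where
  continuous : Continuous f
  update_eq : ∀ x t, f (Function.update x e t) = f x
  mem_iff : ∀ x, x ∈ X ↔ (x ∈ X' ∧ x e = f x) ∨ (x ∈ X'' ∧ f x ≤ x e)
  subset : X'' ⊆ X'
  update_mem' : ∀ x ∈ X', ∀ t, Function.update x e t ∈ X'
  update_mem'' : ∀ x ∈ X'', ∀ t, Function.update x e t ∈ X''

theorem AttainedTwice.update [DecidableEq α] {x : α → ℝ} {S : Set α} (h : AttainedTwice x S)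
    {e : α} (he : e ∉ S) (t : ℝ) : AttainedTwice (Function.update x e t) S := by
  have hu : ∀ i ∈ S, Function.update x e t i = x i := fun i hi =>
    Function.update_of_ne (ne_of_mem_of_not_mem hi he) _ _
  obtain ⟨i, hi, j, hj, hij, hxij, hle⟩ := h
  exact ⟨i, hi, j, hj, hij, by rw [hu i hi, hu j hj, hxij],
    fun k hk => by rw [hu i hi, hu k hk]; exact hle k hk⟩

theorem IsElimFamily.exists_isModification [Finite α] [DecidableEq α] (hF : IsElimFamily F) {e : α}
    {S₀ : Set α} (hS₀ : S₀ ∈ F) (heS₀ : e ∈ S₀) (hne : {e} ∉ F) :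
    ∃ f, IsModification e f (fanOf F) (fanOf (TropicalConnectivity.deleteElt F e))
      (fanOf (TropicalConnectivity.contractElt F e)) := by
  obtain ⟨f, hfc, hfu, hf₁, hf₂⟩ := exists_modification_function hS₀ heS₀ hne
  have hsub : fanOf (TropicalConnectivity.contractElt F e) ⊆
      fanOf (TropicalConnectivity.deleteElt F e) := by
    intro x hx S hS
    have : S = S \ {e} := (Set.sdiff_singleton_eq_self hS.2).symm
    exact hx S ⟨hF.nonempty S hS.1, S, hS.1, this⟩
  refine ⟨f, hfc, hfu, fun x => ⟨fun hx => ?_, ?_⟩, hsub, ?_, ?_⟩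
  · obtain ⟨T, hT, heT, hle⟩ := hf₂ x
    obtain ⟨i, hi, j, hj, hij, hxij, hmin⟩ := hx T hT
    have hge : f x ≤ x e := by
      by_cases hie : i = e
      · rw [← hie, hxij]
        exact hle j hj (fun h => hij (hie.trans h.symm))
      · exact (hle i hi hie).trans (hmin e heT)
    rcases hge.eq_or_lt with heq | hlt
    · exact Or.inl ⟨fun S hS => hx S hS.1, heq.symm⟩
    · refine Or.inr ⟨?_, hge⟩
      rintro _ ⟨hSne, S, hS, rfl⟩
      by_cases heS : e ∈ S
      swap
      · rw [Set.sdiff_singleton_eq_self heS]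
        exact hx S hS
      obtain ⟨i, hi, j, hj, hij, hxij, hmin⟩ := hx S hS
      -- the minimum over `S` is smaller than `x e`
      have hlt' : x i < x e := by
        obtain ⟨k, hk, -, hkf⟩ := hf₁ x S hS heS
        exact (hmin k hk).trans_lt (hkf.trans_lt hlt)
      exact ⟨i, ⟨hi, fun h => hlt'.ne (congrArg x h)⟩, j,
        ⟨hj, fun h => (hxij ▸ hlt').ne (congrArg x h)⟩, hij, hxij, fun k hk => hmin k hk.1⟩
  · rintro (⟨hx, hxe⟩ | ⟨hx, hxe⟩) S hS
    · by_cases heS : e ∈ S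
      swap
      · exact hx S ⟨hS, heS⟩
      obtain ⟨i₀, hi₀, hi₀e, hi₀f⟩ := hf₁ x S hS heS
      obtain ⟨g, hg, hgmin⟩ := Set.exists_min_image (S \ {e}) x (Set.toFinite _) ⟨i₀, hi₀, hi₀e⟩
      have hgf : x g ≤ f x := (hgmin i₀ ⟨hi₀, hi₀e⟩).trans hi₀f
      have hgS : ∀ k ∈ S, x g ≤ x k := fun k hk => by
        by_cases hke : k = e
        · rw [hke, hxe]; exact hgf
        · exact hgmin k ⟨hk, hke⟩
      rcases hgf.eq_or_lt with heq | hlt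
      · exact ⟨g, hg.1, e, heS, hg.2, heq.trans hxe.symm, hgS⟩
      -- otherwise eliminate `e` between `S` and a member on which `f` is attained
      obtain ⟨T, hT, heT, hle⟩ := hf₂ x
      have hgT : g ∉ T := fun h => (hle g h hg.2).not_gt hlt
      obtain ⟨U, hU, hgU, hUsub, heU⟩ := hF.elim S hS T hT e heS heT g hg.1 hgT
      have key : ∀ i ∈ U, x i ≤ x g → i ∈ S := fun i hi hig => (hUsub hi).resolve_right fun hiT =>
        (hle i hiT (fun h => heU (h ▸ hi))).not_gt (hig.trans_lt hlt)
      obtain ⟨i, hi, j, hj, hij, hxij, hmin⟩ := hx U ⟨hU, heU⟩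
      have hig := hmin g hgU
      have hiS := key i hi hig
      have hjS := key j hj (hxij ▸ hig)
      exact ⟨i, hiS, j, hjS, hij, hxij, fun k hk => hig.trans (hgS k hk)⟩
    · by_cases heS : e ∈ S
      swap
      · exact hsub hx S ⟨hS, heS⟩
      obtain ⟨i₀, hi₀, hi₀e, hi₀f⟩ := hf₁ x S hS heS
      obtain ⟨i, hi, j, hj, hij, hxij, hmin⟩ := hx (S \ {e}) ⟨⟨i₀, hi₀, hi₀e⟩, S, hS, rfl⟩
      refine ⟨i, hi.1, j, hj.1, hij, hxij, fun k hk => ?_⟩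
      by_cases hke : k = e
      · rw [hke]
        exact (hmin i₀ ⟨hi₀, hi₀e⟩).trans (hi₀f.trans hxe)
      · exact hmin k ⟨hk, hke⟩
  · intro x hx t S hS
    exact (hx S hS).update hS.2 t
  · rintro x hx t _ ⟨hSne, S, hS, rfl⟩
    exact (hx _ ⟨hSne, S, hS, rfl⟩).update (fun h => h.2 rfl) t

end Modification

/-! ### Bergman fans without subspaces of small dimension -/

section BergmanFan

variable {α : Type*}

/-- Adding the coordinate direction `e` to finitely many subspaces raises their dimensions by at
most one and makes their union invariant under changes of the coordinate `e`. -/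
theorem exists_cylinders [Finite α] [DecidableEq α] (e : α) {Z : Set (Submodule ℝ (α → ℝ))}
    (hZ : Z.Finite) :
    ∃ Z' : Set (Submodule ℝ (α → ℝ)), Z'.Finite ∧
      (∀ W ∈ Z', ∃ W₀ ∈ Z, Module.finrank ℝ W ≤ Module.finrank ℝ W₀ + 1) ∧
      unionOf Z ⊆ unionOf Z' ∧
      ∀ x t, x ∉ unionOf Z' → Function.update x e t ∉ unionOf Z' := by
  refine ⟨(fun W => W ⊔ Submodule.span ℝ {Pi.single e (1 : ℝ)}) '' Z, hZ.image _, ?_, ?_, ?_⟩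
  · rintro _ ⟨W, hW, rfl⟩
    exact ⟨W, hW, finrank_sup_span_singleton_le W _⟩
  · intro x hx
    obtain ⟨W, hW, hxW⟩ := mem_unionOf.1 hx
    exact mem_unionOf.2 ⟨_, ⟨W, hW, rfl⟩, Submodule.mem_sup_left hxW⟩
  · intro x t hx hu
    obtain ⟨_, ⟨W, hW, rfl⟩, hxW⟩ := mem_unionOf.1 hu
    refine hx (mem_unionOf.2 ⟨_, ⟨W, hW, rfl⟩, ?_⟩)
    have : x = Function.update x e t + (x e - t) • Pi.single e (1 : ℝ) := by
      ext i
      by_cases hi : i = e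
      · subst hi; simp
      · simp [hi]
    rw [this]
    exact Submodule.add_mem _ hxW (Submodule.mem_sup_right
      (Submodule.smul_mem _ _ (Submodule.mem_span_singleton_self _)))

variable [DecidableEq α] {e : α} {f : (α → ℝ) → ℝ} {X X' X'' : Set (α → ℝ)}

theorem IsModification.update_mem (h : IsModification e f X X' X'') {x : α → ℝ} (hx : x ∈ X') :
    Function.update x e (f x) ∈ X :=
  (h.mem_iff _).2 (Or.inl ⟨h.update_mem' x hx _, by simp [h.update_eq]⟩)

theorem IsModification.continuous_update (h : IsModification e f X X' X'') :
    Continuous fun x : α → ℝ => Function.update x e (f x) :=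
  continuous_id.update e h.continuous

theorem IsModification.denseOffSubspaces [Finite α] (h : IsModification e f X X' X'') {d : ℕ}
    (h' : DenseOffSubspaces (d + 1) X') (h'' : DenseOffSubspaces d X'') :
    DenseOffSubspaces d X := by
  intro Z hZ hd x hx
  have hgraph : ∀ x ∈ X', x e = f x → x ∈ closure (X \ unionOf Z) := by
    intro x hx hxe
    obtain ⟨Z', hZ', hd', hZZ', hcyl⟩ := exists_cylinders e hZ
    have hx' := h' Z' hZ' (fun W hW => by
      obtain ⟨W₀, hW₀, hle⟩ := hd' W hW
      have := hd W₀ hW₀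
      omega) hx
    have hxu : Function.update x e (f x) = x := by rw [← hxe, Function.update_eq_self]
    have := image_closure_subset_closure_image h.continuous_update ⟨x, hx', hxu⟩
    refine closure_mono ?_ this
    rintro _ ⟨y, hy, rfl⟩
    exact ⟨h.update_mem hy.1, fun hyZ => hcyl y _ hy.2 (hZZ' hyZ)⟩
  rcases (h.mem_iff x).1 hx with ⟨hx', hxe⟩ | ⟨hx', hxe⟩
  · exact hgraph x hx' hxe
  rcases hxe.eq_or_lt with heq | hlt
  · exact hgraph x (h.subset hx') heq.symm
  -- above the graph, `X` agrees with `X''`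
  have hopen : IsOpen {y : α → ℝ | f y < y e} := isOpen_lt h.continuous (continuous_apply e)
  rw [mem_closure_iff] at *
  intro o ho hxo
  obtain ⟨y, ⟨hyo, hye⟩, hyX, hyZ⟩ :=
    mem_closure_iff.1 (h'' Z hZ hd hx') _ (ho.inter hopen) ⟨hxo, hlt⟩
  exact ⟨y, hyo, (h.mem_iff y).2 (Or.inr ⟨hyX, le_of_lt hye⟩), hyZ⟩

/-- The connectedness step. The graph part of `X`, without the cylinders over the removed subspaces,
is the image of a connected part of `X'`. Any other point of `X` is moved off the cylinders by a
short tropical segment, and then vertically down to the graph. -/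
theorem IsModification.preconnectedOffSubspaces [Fintype α] (h : IsModification e f X X' X'')
    {d : ℕ}
    (hconv : ∀ x ∈ X, ∀ y ∈ X, ∀ s t : ℝ, (fun i => min (x i + s) (y i + t)) ∈ X)
    (h' : PreconnectedOffSubspaces (d + 1) X')
    (hd' : DenseOffSubspaces (d + 1) X') (hd'' : DenseOffSubspaces d X'') :
    PreconnectedOffSubspaces d X := by
  intro Z hZ hd
  obtain ⟨Z', hZ', hZ'd, hZZ', hcyl⟩ := exists_cylinders e hZ
  have hZ'd : ∀ W ∈ Z', Module.finrank ℝ W + 1 ≤ d := fun W hW => by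
    obtain ⟨W₀, hW₀, hle⟩ := hZ'd W hW
    have := hd W₀ hW₀
    omega
  set ψ : (α → ℝ) → α → ℝ := fun x => Function.update x e (f x) with hψ
  have hΓ : IsPreconnected (ψ '' (X' \ unionOf Z')) :=
    (h' Z' hZ' fun W hW => by have := hZ'd W hW; omega).image _ h.continuous_update.continuousOn
  have hΓX : ψ '' (X' \ unionOf Z') ⊆ X \ unionOf Z := by
    rintro _ ⟨y, hy, rfl⟩
    exact ⟨h.update_mem hy.1, fun hyZ => hcyl y _ hy.2 (hZZ' hyZ)⟩
  have hclosed := isClosed_unionOf hZ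
  -- a short tropical segment from `x` to a nearby point stays off the removed subspaces
  have hnear : ∀ x ∈ X \ unionOf Z, ∃ ε > 0, ∀ y ∈ X, dist y x < ε →
      ∃ T ⊆ X \ unionOf Z, x ∈ T ∧ y ∈ T ∧ IsPreconnected T := by
    intro x hx
    obtain ⟨ε, hε, hball⟩ := Metric.isOpen_iff.1 hclosed.isOpen_compl x hx.2
    refine ⟨ε, hε, fun y hy hxy => ?_⟩
    obtain ⟨T, hTX, hTb, hxT, hyT, hT⟩ := exists_tropical_path hconv hx.1 hy
    refine ⟨T, fun z hz => ⟨hTX hz, hball ?_⟩, hxT, hyT, hT⟩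
    have := Metric.mem_closedBall.1 (hTb hz)
    rw [dist_comm x y] at this
    exact Metric.mem_ball.2 (this.trans_lt hxy)
  have hgraph : ∀ x ∈ X \ unionOf Z, x ∈ X' → x e = f x →
      ∃ T ⊆ X \ unionOf Z, x ∈ T ∧ (T ∩ ψ '' (X' \ unionOf Z')).Nonempty ∧ IsPreconnected T := by
    intro x hx hx' hxe
    obtain ⟨ε, hε, hT⟩ := hnear x hx
    have hxu : ψ x = x := by simp only [hψ]; rw [← hxe, Function.update_eq_self]
    have hcl := image_closure_subset_closure_image h.continuous_update
      ⟨x, hd' Z' hZ' (fun W hW => by have := hZ'd W hW; omega) hx', hxu⟩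
    obtain ⟨y, hy, hyx⟩ := Metric.mem_closure_iff.1 hcl ε hε
    obtain ⟨T, hTX, hxT, hyT, hT⟩ := hT y (hΓX hy).1 (by rwa [dist_comm])
    exact ⟨T, hTX, hxT, ⟨y, hyT, hy⟩, hT⟩
  have hall : ∀ x ∈ X \ unionOf Z,
      ∃ T ⊆ X \ unionOf Z, x ∈ T ∧ (T ∩ ψ '' (X' \ unionOf Z')).Nonempty ∧ IsPreconnected T := by
    intro x hx
    rcases (h.mem_iff x).1 hx.1 with ⟨hx', hxe⟩ | ⟨hx', hxe⟩
    · exact hgraph x hx hx' hxe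
    rcases hxe.eq_or_lt with heq | hlt
    · exact hgraph x hx (h.subset hx') heq.symm
    obtain ⟨ε, hε, hT⟩ := hnear x hx
    have hopen : IsOpen {y : α → ℝ | f y < y e} := isOpen_lt h.continuous (continuous_apply e)
    obtain ⟨y, ⟨hyb, hye⟩, hyX, hyZ⟩ := mem_closure_iff.1
      (hd'' Z' hZ' (fun W hW => by have := hZ'd W hW; omega) hx') _
      (Metric.isOpen_ball.inter hopen) ⟨Metric.mem_ball_self hε, hlt⟩
    have hye' : f y ≤ y e := le_of_lt hye
    obtain ⟨T, hTX, hxT, hyT, hT⟩ := hT y ((h.mem_iff y).2 (Or.inr ⟨hyX, hye'⟩)) hyb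
    -- the vertical segment from `y` down to the graph
    have hv : IsPreconnected ((fun t => Function.update y e t) '' Set.Icc (f y) (y e)) :=
      isPreconnected_Icc.image _ (Continuous.continuousOn (by fun_prop))
    refine ⟨T ∪ (fun t => Function.update y e t) '' Set.Icc (f y) (y e), Set.union_subset hTX ?_,
      Or.inl hxT, ⟨ψ y, Or.inr ⟨f y, ⟨le_rfl, hye'⟩, rfl⟩, y, ⟨h.subset hyX, hyZ⟩, rfl⟩,
      IsPreconnected.union y hyT ⟨y e, ⟨hye', le_rfl⟩, Function.update_eq_self _ _⟩ hT hv⟩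
    rintro _ ⟨t, ht, rfl⟩
    refine ⟨(h.mem_iff _).2 (Or.inr ⟨h.update_mem'' y hyX t, ?_⟩),
      fun htZ => hcyl y t hyZ (hZZ' htZ)⟩
    simpa [h.update_eq] using ht.1
  refine isPreconnected_of_forall_pair fun x hx y hy => ?_
  obtain ⟨S, hSX, hxS, ⟨p, hpS, hp⟩, hS⟩ := hall x hx
  obtain ⟨T, hTX, hyT, ⟨q, hqT, hq⟩, hT⟩ := hall y hy
  exact ⟨S ∪ ψ '' (X' \ unionOf Z') ∪ T, Set.union_subset (Set.union_subset hSX hΓX) hTX,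
    Or.inl (Or.inl hxS), Or.inr hyT,
    IsPreconnected.union q (Or.inr hq) hqT (IsPreconnected.union p hpS hp hS hΓ) hT⟩

end BergmanFan

section Rank

variable {α : Type*}

theorem fanOf_eq_empty {F : Set (Set α)} {e : α} (he : {e} ∈ F) : fanOf F = ∅ := by
  refine Set.eq_empty_of_forall_notMem fun x hx => ?_
  obtain ⟨i, rfl, j, rfl, hij, -⟩ := hx _ he
  exact hij rfl

/-- The fan of an elimination family of rank `d` has pure dimension at least `d` and is connected
through codimension one. The proof is by induction on the number of elements that are not
coloops, through tropical modifications. -/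
theorem IsElimFamily.dense_and_preconnected [Fintype α] {F : Set (Set α)} (hF : IsElimFamily F)
    {B : Set α} (hB : hF.matroid.IsBase B) :
    DenseOffSubspaces B.ncard (fanOf F) ∧ PreconnectedOffSubspaces B.ncard (fanOf F) := by
  classical
  induction h : (⋃₀ F).ncard using Nat.strong_induction_on generalizing F B with
  | _ n ih =>
  subst h
  by_cases hFe : F = ∅
  · subst hFe
    have hfan : fanOf (∅ : Set (Set α)) = Set.univ := by simp [fanOf]
    have hBu : B = Set.univ := Set.univ_subset_iff.1
      ((hF.matroid_isBase.1 hB).2 (y := Set.univ) (fun S hS => absurd hS (by simp))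
        (Set.subset_univ _))
    have hcard : B.ncard = Module.finrank ℝ (α → ℝ) := by
      rw [hBu, Set.ncard_univ, Nat.card_eq_fintype_card, Module.finrank_fintype_fun_eq_card]
    rw [hfan, hcard]
    exact ⟨denseOffSubspaces_univ, preconnectedOffSubspaces_univ⟩
  obtain ⟨S, hS⟩ := Set.nonempty_iff_ne_empty.2 hFe
  obtain ⟨e, he⟩ := hF.nonempty S hS
  by_cases hloop : {e} ∈ F
  · rw [fanOf_eq_empty hloop]
    exact ⟨fun Z _ _ => Set.empty_subset _, fun Z _ _ => by
      rw [Set.empty_sdiff]; exact isPreconnected_empty⟩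
  obtain ⟨f, hf⟩ := hF.exists_isModification hS he hloop
  obtain ⟨B₁, hB₁, heB₁, hB₁'⟩ := hF.exists_isBase_deleteElt hS he
  obtain ⟨B₂, hB₂, hB₂'⟩ := hF.exists_isBase_contractElt hloop
  have hlt : ∀ G : Set (Set α), (∀ T ∈ G, ∃ U ∈ F, T ⊆ U \ {e}) →
      (⋃₀ G).ncard < (⋃₀ F).ncard := by
    intro G hG
    refine Set.ncard_lt_ncard ⟨?_, fun hh => ?_⟩ (Set.toFinite _)
    · rintro x ⟨T, hT, hx⟩
      obtain ⟨U, hU, hTU⟩ := hG T hT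
      exact ⟨U, hU, (hTU hx).1⟩
    · obtain ⟨T, hT, heT⟩ := hh ⟨S, hS, he⟩
      obtain ⟨U, -, hTU⟩ := hG T hT
      exact (hTU heT).2 rfl
  have ih₁ := ih _ (hlt _ fun T hT => ⟨T, hT.1, fun x hx =>
    ⟨hx, fun h => hT.2 (h ▸ hx)⟩⟩) (hF.deleteElt e) hB₁' rfl
  have ih₂ := ih _ (hlt _ fun T hT => by
    obtain ⟨-, U, hU, rfl⟩ := hT
    exact ⟨U, hU, subset_rfl⟩) (hF.contractElt e) hB₂' rfl
  rw [Set.ncard_insert_of_notMem heB₁, hB₁.ncard_eq_ncard_of_isBase hB] at ih₁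
  rw [hB₂.ncard_eq_ncard_of_isBase hB] at ih₂
  exact ⟨hf.denseOffSubspaces ih₁.1 ih₂.1,
    hf.preconnectedOffSubspaces (fun x hx y hy => min_add_mem_fanOf hx hy) ih₁.2 ih₁.1 ih₂.1⟩

/-- The functions that factor through `φ`. -/
def factorSubspace (φ : α → α) : Submodule ℝ (α → ℝ) where
  carrier := {x | ∀ i, x (φ i) = x i}
  add_mem' hx hy i := by simp [hx i, hy i]
  zero_mem' _ := rfl
  smul_mem' c x hx i := by simp [hx i]

theorem finrank_factorSubspace_le [Finite α] (φ : α → α) :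
    Module.finrank ℝ (factorSubspace φ) ≤ (Set.range φ).ncard := by
  have := Fintype.ofFinite α
  classical
  let g : factorSubspace φ →ₗ[ℝ] (Set.range φ → ℝ) :=
    (LinearMap.funLeft ℝ ℝ (Subtype.val : Set.range φ → α)).comp (factorSubspace φ).subtype
  have hg : Function.Injective g := by
    intro x y hxy
    ext i
    have := congrFun hxy ⟨φ i, i, rfl⟩
    simp only [g, LinearMap.comp_apply, LinearMap.funLeft_apply, Submodule.subtype_apply] at this
    rwa [x.2 i, y.2 i] at this
  have := LinearMap.finrank_le_finrank_of_injective hg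
  rwa [Module.finrank_fintype_fun_eq_card, ← Nat.card_eq_fintype_card] at this

/-- A point of the fan takes at most as many values as the rank, so that the fan of an elimination
family of rank `d` is covered by finitely many subspaces of dimension at most `d`. -/
theorem IsElimFamily.exists_cover [Finite α] {F : Set (Set α)} (hF : IsElimFamily F)
    {B : Set α} (hB : hF.matroid.IsBase B) :
    ∃ Z : Set (Submodule ℝ (α → ℝ)), Z.Finite ∧ (∀ W ∈ Z, Module.finrank ℝ W ≤ B.ncard) ∧
      (∀ W ∈ Z, (fun _ => 1) ∈ W) ∧ fanOf F ⊆ unionOf Z := by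
  refine ⟨factorSubspace '' {φ | FamilyIndep F (Set.range φ)}, (Set.toFinite _).image _, ?_, ?_, ?_⟩
  · rintro _ ⟨φ, hφ, rfl⟩
    obtain ⟨B', hB', hφB⟩ := (hF.matroid_indep.2 hφ).exists_isBase_superset
    rw [hB.ncard_eq_ncard_of_isBase hB']
    exact (finrank_factorSubspace_le φ).trans (Set.ncard_le_ncard hφB (Set.toFinite _))
  · rintro _ ⟨φ, -, rfl⟩ i
    rfl
  · intro x hx
    -- `φ` picks a representative of each level set of `x`
    set φ : α → α := fun i => Set.rangeSplitting x (Set.rangeFactorization x i)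
    have hφ : ∀ i, x (φ i) = x i := fun i => Set.apply_rangeSplitting x _
    refine mem_unionOf.2 ⟨_, ⟨φ, familyIndep_of_injOn hx ?_, rfl⟩, hφ⟩
    rintro _ ⟨i, rfl⟩ _ ⟨j, rfl⟩ hij
    rw [hφ, hφ] at hij
    exact congrArg (Set.rangeSplitting x) (Subtype.ext hij)

end Rank

/-! ### Linear images of Bergman fans -/

section LinearImage

/-- A subset of a vector space that, for the purpose of codimension-one connectivity, behaves like a
pure `d`-dimensional fan connected through codimension one. No polyhedral structure is involved: the
conditions refer only to finite unions of subspaces. -/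
structure IsConnectedFan {E : Type*} [AddCommGroup E] [Module ℝ E] [TopologicalSpace E]
    (d : ℕ) (X : Set E) : Prop where
  cover : ∃ Z : Set (Submodule ℝ E), Z.Finite ∧ (∀ W ∈ Z, Module.finrank ℝ W ≤ d) ∧
    X ⊆ unionOf Z
  dense : DenseOffSubspaces d X
  preconnected : PreconnectedOffSubspaces d X

variable {E E' : Type*} [AddCommGroup E] [Module ℝ E] [AddCommGroup E'] [Module ℝ E']

theorem finrank_map_add_finrank_ker_inf [FiniteDimensional ℝ E] (g : E →ₗ[ℝ] E')
    (U : Submodule ℝ E) :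
    Module.finrank ℝ (U.map g) + Module.finrank ℝ (LinearMap.ker g ⊓ U : Submodule ℝ E) =
      Module.finrank ℝ U := by
  rw [← LinearMap.finrank_range_add_finrank_ker (g.domRestrict U), LinearMap.range_domRestrict,
    LinearMap.ker_domRestrict, ← Submodule.finrank_map_subtype_eq U (Submodule.comap _ _),
    Submodule.map_comap_subtype, inf_comm]

variable [TopologicalSpace E] [TopologicalSpace E']

/-- A linear map whose kernel on the span of `X` lies in all subspaces of a cover of `X` sends `X`
to a fan of the same kind, whose dimension drops by that of the kernel. -/
theorem IsConnectedFan.of_image [FiniteDimensional ℝ E] [FiniteDimensional ℝ E'] {g : E →ₗ[ℝ] E'}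
    (hg : Continuous g) {d : ℕ} {X : Set E} (hne : X.Nonempty)
    (hcov : ∃ Z : Set (Submodule ℝ E), Z.Finite ∧ (∀ W ∈ Z, Module.finrank ℝ W ≤ d) ∧
      (∀ W ∈ Z, LinearMap.ker g ⊓ Submodule.span ℝ X ≤ W) ∧ X ⊆ unionOf Z)
    (hdense : DenseOffSubspaces d X) (hconn : PreconnectedOffSubspaces d X) :
    ∃ d', IsConnectedFan d' (g '' X) := by
  set K := LinearMap.ker g ⊓ Submodule.span ℝ X with hK
  obtain ⟨Z₀, hZ₀, hZ₀d, hZ₀K, hZ₀X⟩ := hcov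
  have hKd : Module.finrank ℝ K ≤ d := by
    obtain ⟨x, hx⟩ := hne
    obtain ⟨W, hW, -⟩ := mem_unionOf.1 (hZ₀X hx)
    exact (Submodule.finrank_mono (hZ₀K W hW)).trans (hZ₀d W hW)
  -- the inverse image in the span of `X` of a subspace
  let C : Submodule ℝ E' → Submodule ℝ E := fun W => W.comap g ⊓ Submodule.span ℝ X
  have hC : ∀ W, Module.finrank ℝ (C W) ≤ Module.finrank ℝ W + Module.finrank ℝ K := by
    intro W
    rw [← finrank_map_add_finrank_ker_inf g (C W)]
    gcongr
    · exact Submodule.finrank_mono (Submodule.map_le_iff_le_comap.2 inf_le_left)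
    · exact Submodule.finrank_mono (inf_le_inf_left _ inf_le_right)
  have himage : ∀ Z : Set (Submodule ℝ E'),
      g '' X \ unionOf Z = g '' (X \ unionOf (C '' Z)) := by
    intro Z
    ext y
    constructor
    · rintro ⟨⟨x, hx, rfl⟩, hy⟩
      refine ⟨x, ⟨hx, fun h => ?_⟩, rfl⟩
      obtain ⟨_, ⟨W, hW, rfl⟩, hxW⟩ := mem_unionOf.1 h
      exact hy (mem_unionOf.2 ⟨W, hW, hxW.1⟩)
    · rintro ⟨x, ⟨hx, hxZ⟩, rfl⟩
      refine ⟨⟨x, hx, rfl⟩, fun h => hxZ ?_⟩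
      obtain ⟨W, hW, hxW⟩ := mem_unionOf.1 h
      exact mem_unionOf.2 ⟨C W, ⟨W, hW, rfl⟩, hxW, Submodule.subset_span hx⟩
  refine ⟨d - Module.finrank ℝ K, ⟨Submodule.map g '' Z₀, hZ₀.image _, ?_, ?_⟩,
    fun Z hZ hd => ?_, fun Z hZ hd => ?_⟩
  · rintro _ ⟨W, hW, rfl⟩
    have h₁ := finrank_map_add_finrank_ker_inf g W
    have h₂ : Module.finrank ℝ K ≤ Module.finrank ℝ (LinearMap.ker g ⊓ W : Submodule ℝ E) :=
      Submodule.finrank_mono (le_inf inf_le_left (hZ₀K W hW))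
    have := hZ₀d W hW
    omega
  · rintro _ ⟨x, hx, rfl⟩
    obtain ⟨W, hW, hxW⟩ := mem_unionOf.1 (hZ₀X hx)
    exact mem_unionOf.2 ⟨_, ⟨W, hW, rfl⟩, Submodule.mem_map_of_mem hxW⟩
  · rw [himage Z]
    refine Set.Subset.trans (Set.image_mono (hdense (C '' Z) (hZ.image _) ?_))
      (image_closure_subset_closure_image hg)
    rintro _ ⟨W, hW, rfl⟩
    have := hC W
    have := hd W hW
    omega
  · rw [himage Z]
    refine (hconn (C '' Z) (hZ.image _) ?_).image _ hg.continuousOn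
    rintro _ ⟨W, hW, rfl⟩
    have := hC W
    have := hd W hW
    omega

/-- The inverse of a linear isomorphism of the spans of two sets extends to a linear map of the
ambient space that is injective on the span of the second set. -/
theorem LinearlyIsomorphic.exists_linearMap {V W : Type*} [AddCommGroup V] [Module ℝ V]
    [AddCommGroup W] [Module ℝ W] {A : Set V} {B : Set W} (h : LinearlyIsomorphic A B) :
    ∃ g : W →ₗ[ℝ] V, g '' B = A ∧ LinearMap.ker g ⊓ Submodule.span ℝ B = ⊥ := by
  obtain ⟨e, he⟩ := h
  obtain ⟨g, hg⟩ := LinearMap.exists_extend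
    ((Submodule.span ℝ A).subtype ∘ₗ e.symm.toLinearMap)
  have hg' : ∀ w : Submodule.span ℝ B, g w = e.symm w := fun w => LinearMap.congr_fun hg w
  refine ⟨g, Set.Subset.antisymm ?_ fun a ha => ?_, ?_⟩
  · rintro _ ⟨b, hb, rfl⟩
    rw [hg' ⟨b, Submodule.subset_span hb⟩, ← he, LinearEquiv.apply_symm_apply]
    exact hb
  · have := (he ⟨a, Submodule.subset_span ha⟩).2 ha
    exact ⟨_, this, by rw [hg', LinearEquiv.symm_apply_apply]⟩
  · rw [eq_bot_iff]
    rintro w ⟨hw, hwB⟩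
    have h0 := hg' ⟨w, hwB⟩
    rw [show g w = 0 from hw] at h0
    have h1 : e.symm ⟨w, hwB⟩ = 0 := Subtype.ext h0.symm
    simpa using congrArg Subtype.val ((LinearEquiv.map_eq_zero_iff _).1 h1)

variable {ι : Type*} [Finite ι]

/-- A nonempty set that is linearly isomorphic to the Bergman fan of a matroid, possibly modulo
`ℝ·(1, …, 1)`, is a connected fan. -/
theorem isConnectedFan_of_linearlyIsomorphic {X : Set (ι → ℝ)} (hX : X.Nonempty) {m : ℕ}
    {M : Matroid (Fin m)} (h : LinearlyIsomorphic X (bergmanFan M) ∨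
      LinearlyIsomorphic X (projBergmanFan M)) : ∃ d, IsConnectedFan d X := by
  have hF := isElimFamily_isCircuit M
  have hfan : fanOf {C | M.IsCircuit C} = bergmanFan M := rfl
  obtain ⟨B, hB⟩ := hF.matroid.exists_isBase
  obtain ⟨Z, hZ, hZd, hZ1, hZX⟩ := hF.exists_cover hB
  obtain ⟨hdense, hconn⟩ := hF.dense_and_preconnected hB
  rw [hfan] at hZX hdense hconn
  obtain ⟨g, rfl, hker⟩ : ∃ g : (Fin m → ℝ) →ₗ[ℝ] (ι → ℝ), g '' bergmanFan M = X ∧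
      LinearMap.ker g ⊓ Submodule.span ℝ (bergmanFan M) ≤ onesLine m := by
    rcases h with h | h
    · obtain ⟨g, hgX, hker⟩ := h.exists_linearMap
      exact ⟨g, hgX, hker.le.trans bot_le⟩
    · obtain ⟨g, hgX, hker⟩ := h.exists_linearMap
      refine ⟨g ∘ₗ (onesLine m).mkQ, ?_, ?_⟩
      · rw [← hgX, projBergmanFan, Set.image_image]
        rfl
      · rintro v ⟨hv, hvB⟩
        have hmem : (onesLine m).mkQ v ∈ LinearMap.ker g ⊓ Submodule.span ℝ (projBergmanFan M) := by
          refine ⟨hv, ?_⟩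
          rw [projBergmanFan, ← Submodule.map_span]
          exact Submodule.mem_map_of_mem hvB
        rw [hker, Submodule.mem_bot] at hmem
        exact (Submodule.Quotient.mk_eq_zero _).1 hmem
  refine IsConnectedFan.of_image g.continuous_of_finiteDimensional (Set.image_nonempty.1 hX)
    ⟨Z, hZ, hZd, fun W hW => hker.trans ?_, hZX⟩ hdense hconn
  rw [onesLine, Submodule.span_singleton_le_iff_mem]
  exact hZ1 W hW

end LinearImage

/-! ### Polyhedra and their faces -/

section Polyhedra

variable {ι : Type*} {P F : Set (ι → ℝ)}

theorem IsPolyhedron.convex (hP : IsPolyhedron P) : Convex ℝ P := by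
  obtain ⟨s, rfl⟩ := hP
  simp only [Set.ofPred_forall]
  exact convex_iInter₂ fun a _ => convex_halfSpace_le a.1.isLinear a.2

theorem IsPolyhedron.isClosed [Finite ι] (hP : IsPolyhedron P) : IsClosed P := by
  obtain ⟨s, rfl⟩ := hP
  simp only [Set.ofPred_forall]
  exact isClosed_biInter fun a _ =>
    isClosed_le a.1.continuous_of_finiteDimensional continuous_const

/-- A relative interior point of a convex set: every segment in the set that ends at the point can
be prolonged beyond it. -/
def IsRelInteriorPoint (w : ι → ℝ) (P : Set (ι → ℝ)) : Prop :=
  w ∈ P ∧ ∀ y ∈ P, ∃ δ > (0 : ℝ), w - δ • (y - w) ∈ P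

/-- A point at which as few inequalities as possible are tight is a relative interior point. -/
theorem IsPolyhedron.exists_isRelInteriorPoint (hP : IsPolyhedron P) (hne : P.Nonempty) :
    ∃ w, IsRelInteriorPoint w P := by
  classical
  obtain ⟨s, rfl⟩ := hP
  let tight : (ι → ℝ) → Finset (((ι → ℝ) →ₗ[ℝ] ℝ) × ℝ) := fun x => s.filter fun a => a.1 x = a.2
  obtain ⟨w, hw, hmin⟩ := exists_minimalFor_of_wellFoundedLT
    (fun x => x ∈ {x | ∀ a ∈ s, a.1 x ≤ a.2}) (fun x => (tight x).card) hne
  refine ⟨w, hw, fun y hy => ?_⟩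
  -- the inequalities that are tight at `w` are tight at `y`, or the midpoint would do better
  have htight : ∀ a ∈ s, a.1 w = a.2 → a.1 y = a.2 := by
    set m : ι → ℝ := (2⁻¹ : ℝ) • w + (2⁻¹ : ℝ) • y with hm
    have hma : ∀ a : ((ι → ℝ) →ₗ[ℝ] ℝ) × ℝ, a.1 m = (a.1 w + a.1 y) / 2 := by
      intro a
      simp only [hm, map_add, map_smul, smul_eq_mul]
      ring
    have hmP : ∀ a ∈ s, a.1 m ≤ a.2 := fun a ha => by
      rw [hma]; linarith [hw a ha, hy a ha]
    have hsub : tight m ⊆ tight w := by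
      intro a ha
      obtain ⟨has, ham⟩ := Finset.mem_filter.1 ha
      rw [hma] at ham
      exact Finset.mem_filter.2 ⟨has, by linarith [hw a has, hy a has]⟩
    have heq : tight m = tight w := Finset.eq_of_subset_of_card_le hsub
      (hmin hmP (Finset.card_le_card hsub))
    intro a ha haw
    have : a ∈ tight m := heq ▸ Finset.mem_filter.2 ⟨ha, haw⟩
    have ham := (Finset.mem_filter.1 this).2
    rw [hma] at ham
    linarith
  have hev : ∀ᶠ δ in 𝓝[>] (0 : ℝ), ∀ a ∈ s, a.1 (w - δ • (y - w)) ≤ a.2 := by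
    rw [Filter.eventually_all_finset]
    intro a ha
    simp only [map_sub, map_smul, smul_eq_mul]
    rcases (hw a ha).eq_or_lt with heq | hlt
    · exact Filter.Eventually.of_forall fun δ => by
        rw [htight a ha heq, heq]; simp
    · have hcont : Filter.Tendsto (fun δ : ℝ => a.1 w - δ * (a.1 y - a.1 w)) (𝓝[>] 0)
          (𝓝 (a.1 w - 0 * (a.1 y - a.1 w))) :=
        (Continuous.tendsto (by fun_prop) 0).mono_left nhdsWithin_le_nhds
      rw [zero_mul, sub_zero] at hcont
      exact (hcont.eventually_lt_const hlt).mono fun δ h => h.le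
  obtain ⟨δ, hδ, hδ0⟩ := (hev.and self_mem_nhdsWithin).exists
  exact ⟨δ, hδ0, hδ⟩

theorem IsFace.subset (h : IsFace F P) : F ⊆ P := h.2.subset

theorem IsFace.exists_linear (h : IsFace F P) :
    ∃ l : (ι → ℝ) →ₗ[ℝ] ℝ, F = {x ∈ P | ∀ y ∈ P, l y ≤ l x} := by
  obtain ⟨l, hl⟩ := h.2 h.1
  exact ⟨l, hl⟩

/-- A face that contains a relative interior point is the whole polyhedron. -/
theorem IsFace.eq_of_isRelInteriorPoint (h : IsFace F P) {w : ι → ℝ} (hw : IsRelInteriorPoint w P)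
    (hwF : w ∈ F) : F = P := by
  obtain ⟨l, rfl⟩ := h.exists_linear
  refine h.subset.antisymm fun y hy => ⟨hy, fun z hz => (hwF.2 z hz).trans ?_⟩
  obtain ⟨δ, hδ, hmem⟩ := hw.2 y hy
  have := hwF.2 _ hmem
  simp only [map_sub, map_smul, smul_eq_mul] at this
  nlinarith

/-- Faces are extreme: a face that contains an interior point of a segment contains its endpoint. -/
theorem IsFace.mem_of_add_smul_mem (h : IsFace F P) {x y : ι → ℝ} (hx : x ∈ P) (hy : y ∈ P)
    {ε : ℝ} (h0 : 0 < ε) (h1 : ε < 1) (hmem : x + ε • (y - x) ∈ F) : y ∈ F := by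
  obtain ⟨l, rfl⟩ := h.exists_linear
  refine ⟨hy, fun z hz => (hmem.2 z hz).trans ?_⟩
  have := hmem.2 x hx
  simp only [map_sub, map_add, map_smul, smul_eq_mul] at this ⊢
  have : l x ≤ l y := by
    have h3 : 0 ≤ ε * (l y - l x) := by linarith
    linarith [(mul_nonneg_iff_of_pos_left h0).1 h3]
  nlinarith

/-- A face of full dimension is the whole polyhedron. -/
theorem IsFace.eq_of_cellDim_le [Finite ι] (h : IsFace F P) (hd : cellDim P ≤ cellDim F) :
    F = P := by
  by_contra hne
  obtain ⟨y, hyP, hyF⟩ := Set.exists_of_ssubset (h.subset.ssubset_of_ne hne)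
  obtain ⟨x, hxF⟩ := h.1
  have hlt : vectorSpan ℝ F < vectorSpan ℝ P := by
    refine (vectorSpan_mono ℝ h.subset).lt_of_ne fun heq => ?_
    have hmem : y -ᵥ x ∈ vectorSpan ℝ F := by
      rw [heq]; exact vsub_mem_vectorSpan ℝ hyP (h.subset hxF)
    obtain ⟨l, rfl⟩ := h.exists_linear
    have hker : vectorSpan ℝ {x ∈ P | ∀ y ∈ P, l y ≤ l x} ≤ LinearMap.ker l := by
      rw [vectorSpan_def, Submodule.span_le]
      rintro _ ⟨p, hp, q, hq, rfl⟩
      have := le_antisymm (hp.2 q hq.1) (hq.2 p hp.1)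
      simp [this]
    have hl : l y = l x := by
      have := hker hmem
      rw [LinearMap.mem_ker, vsub_eq_sub, map_sub] at this
      linarith
    exact hyF ⟨hyP, fun z hz => hl ▸ hxF.2 z hz⟩
  exact (Submodule.finrank_lt_finrank_of_lt hlt).not_ge hd

end Polyhedra

/-! ### Cones of directions and stars -/

section Star

variable {ι : Type*} {P Q : Set (ι → ℝ)} {w v : ι → ℝ}

theorem mem_coneAt : v ∈ coneAt w P ↔ ∀ᶠ ε in 𝓝[>] (0 : ℝ), w + ε • v ∈ P := Iff.rfl

theorem mem_coneAt_of_add_smul_mem (hP : Convex ℝ P) (hw : w ∈ P) {ε : ℝ} (hε : 0 < ε)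
    (h : w + ε • v ∈ P) : v ∈ coneAt w P := by
  filter_upwards [Ioo_mem_nhdsGT hε] with δ hδ
  have := hP.add_smul_sub_mem hw h (t := δ / ε)
    ⟨(div_pos hδ.1 hε).le, (div_le_one hε).2 hδ.2.le⟩
  rwa [add_sub_cancel_left, smul_smul, div_mul_cancel₀ _ hε.ne'] at this

theorem exists_add_smul_mem (h : v ∈ coneAt w P) : ∃ ε : ℝ, 0 < ε ∧ ε < 1 ∧ w + ε • v ∈ P := by
  obtain ⟨ε, h, h'⟩ :=
    ((mem_coneAt.1 h).and (Ioo_mem_nhdsGT (zero_lt_one' ℝ))).exists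
  exact ⟨ε, h'.1, h'.2, h⟩

theorem coneAt_inter : coneAt w (P ∩ Q) = coneAt w P ∩ coneAt w Q := by
  ext v
  simp only [Set.mem_inter_iff, mem_coneAt, Filter.eventually_and]

theorem coneAt_mono (h : P ⊆ Q) : coneAt w P ⊆ coneAt w Q :=
  fun _ hv => mem_coneAt.2 ((mem_coneAt.1 hv).mono fun _ hx => h hx)

theorem zero_mem_coneAt (hw : w ∈ P) : (0 : ι → ℝ) ∈ coneAt w P :=
  mem_coneAt.2 (Filter.Eventually.of_forall fun ε => by simpa using hw)

theorem convex_coneAt (hP : Convex ℝ P) : Convex ℝ (coneAt w P) := by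
  intro u hu v hv a b ha hb hab
  rw [mem_coneAt] at *
  filter_upwards [hu, hv] with ε h₁ h₂
  have := hP h₁ h₂ ha hb hab
  have heq : w + ε • (a • u + b • v) = a • (w + ε • u) + b • (w + ε • v) := by
    have hw : w = a • w + b • w := by rw [← add_smul, hab, one_smul]
    conv_lhs => rw [hw]
    module
  rwa [heq]

theorem span_coneAt (hP : Convex ℝ P) (hw : w ∈ P) :
    Submodule.span ℝ (coneAt w P) = vectorSpan ℝ P := by
  refine le_antisymm (Submodule.span_le.2 fun v hv => ?_) ?_
  · obtain ⟨ε, h0, -, hmem⟩ := exists_add_smul_mem hv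
    have := vsub_mem_vectorSpan ℝ hmem hw
    rw [vsub_eq_sub, add_sub_cancel_left] at this
    exact (Submodule.smul_mem_iff _ h0.ne').1 this
  · rw [vectorSpan_eq_span_vsub_set_right ℝ hw, Submodule.span_le]
    rintro _ ⟨p, hp, rfl⟩
    exact Submodule.subset_span (mem_coneAt_of_add_smul_mem hP hw one_pos (by simpa using hp))

theorem cellDim_coneAt (hP : Convex ℝ P) (hw : w ∈ P) : cellDim (coneAt w P) = cellDim P := by
  have himage : (fun x : ι → ℝ => x -ᵥ (0 : ι → ℝ)) '' coneAt w P = coneAt w P := by simp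
  rw [cellDim, cellDim, vectorSpan_eq_span_vsub_set_right ℝ (zero_mem_coneAt hw), himage,
    span_coneAt hP hw]

theorem finrank_span_coneAt (hP : Convex ℝ P) (hw : w ∈ P) :
    Module.finrank ℝ (Submodule.span ℝ (coneAt w P)) = cellDim P := by
  rw [span_coneAt hP hw, cellDim]

theorem IsPolyhedron.isClosed_coneAt [Finite ι] (hP : IsPolyhedron P) (hw : w ∈ P) :
    IsClosed (coneAt w P) := by
  obtain ⟨s, rfl⟩ := hP
  -- the cone is cut out by the inequalities that are tight at `w`
  have : coneAt w {x | ∀ a ∈ s, a.1 x ≤ a.2} = ⋂ a ∈ s, {v | a.1 w = a.2 → a.1 v ≤ 0} := by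
    ext v
    rw [mem_coneAt, Set.mem_iInter₂]
    simp only [Set.mem_ofPred_eq]
    rw [Filter.eventually_all_finset]
    refine forall₂_congr fun a ha => ?_
    simp only [map_add, map_smul, smul_eq_mul]
    constructor
    · intro h heq
      obtain ⟨ε, hε, hε0⟩ := (h.and self_mem_nhdsWithin).exists
      change 0 < ε at hε0
      by_contra! hpos
      nlinarith [mul_pos hε0 hpos]
    · intro h
      rcases (hw a ha).eq_or_lt with heq | hlt
      · filter_upwards [self_mem_nhdsWithin] with ε hε
        change 0 < ε at hε
        nlinarith [h heq]
      · have hcont : Filter.Tendsto (fun δ : ℝ => a.1 w + δ * a.1 v) (𝓝[>] 0)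
            (𝓝 (a.1 w + 0 * a.1 v)) :=
          (Continuous.tendsto (by fun_prop) 0).mono_left nhdsWithin_le_nhds
        rw [zero_mul, add_zero] at hcont
        exact (hcont.eventually_lt_const hlt).mono fun δ h => h.le
  rw [this]
  refine isClosed_biInter fun a _ => ?_
  by_cases h : a.1 w = a.2
  · simpa [h] using isClosed_le a.1.continuous_of_finiteDimensional continuous_const
  · simp [h]

variable {S : Set (Set (ι → ℝ))}

theorem IsPolyhedralComplex.convex (hS : IsPolyhedralComplex S) {σ : Set (ι → ℝ)} (hσ : σ ∈ S) :
    Convex ℝ σ := (hS.isPolyhedron σ hσ).convex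

theorem IsPolyhedralComplex.inter_mem (hS : IsPolyhedralComplex S) {σ τ : Set (ι → ℝ)} (hσ : σ ∈ S)
    (hτ : τ ∈ S) (hne : (σ ∩ τ).Nonempty) : σ ∩ τ ∈ S :=
  hS.face_mem σ hσ _ (hS.inter_face σ hσ τ hτ hne).1

theorem IsPolyhedralComplex.finite_mem (hS : IsPolyhedralComplex S) (w : ι → ℝ) :
    {σ ∈ S | w ∈ σ}.Finite := by
  by_cases hw : w ∈ ⋃₀ S
  · obtain ⟨U, hU, hfin⟩ := hS.locallyFinite w hw
    exact hfin.subset fun σ hσ => ⟨hσ.1, w, hσ.2, mem_of_mem_nhds hU⟩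
  · convert Set.finite_empty
    exact Set.eq_empty_of_forall_notMem fun σ hσ => hw ⟨σ, hσ⟩

/-- Near a point `x` of the support, all cells contain `x`. -/
theorem IsPolyhedralComplex.eventually_mem [Finite ι] (hS : IsPolyhedralComplex S) {x : ι → ℝ}
    (hx : x ∈ support S) : ∀ᶠ y in 𝓝 x, ∀ σ ∈ S, y ∈ σ → x ∈ σ := by
  obtain ⟨U, hU, hfin⟩ := hS.locallyFinite x hx
  have : ∀ᶠ y in 𝓝 x, ∀ σ ∈ {σ ∈ S | (σ ∩ U).Nonempty}, y ∈ σ → x ∈ σ := by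
    rw [Filter.eventually_all_finite hfin]
    intro σ hσ
    by_cases hxσ : x ∈ σ
    · exact Filter.Eventually.of_forall fun _ _ => hxσ
    · filter_upwards [(hS.isPolyhedron σ hσ.1).isClosed.isOpen_compl.mem_nhds hxσ] with y hy hyσ
      exact absurd hyσ hy
  filter_upwards [this, hU] with y hy hyU σ hσ hyσ
  exact hy σ ⟨hσ, y, hyσ, hyU⟩ hyσ

theorem support_starAt [Finite ι] (hS : IsPolyhedralComplex S) (hw : w ∈ support S) :
    support (starAt S w) = coneAt w (support S) := by
  ext v
  constructor
  · rintro ⟨_, ⟨σ, hσ, rfl⟩, hv⟩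
    exact coneAt_mono (Set.subset_sUnion_of_mem hσ.1) hv
  · intro hv
    have htend : Filter.Tendsto (fun ε : ℝ => w + ε • v) (𝓝[>] 0) (𝓝 (w + (0 : ℝ) • v)) :=
      (Continuous.tendsto (by fun_prop) 0).mono_left nhdsWithin_le_nhds
    rw [zero_smul, add_zero] at htend
    obtain ⟨ε, ⟨hε₁, hε₂⟩, hε₃⟩ := (((mem_coneAt.1 hv).and
      (htend.eventually (hS.eventually_mem hw))).and self_mem_nhdsWithin).exists
    obtain ⟨σ, hσ, hmem⟩ := hε₁
    have hwσ := hε₂ σ hσ hmem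
    exact ⟨_, ⟨σ, ⟨hσ, hwσ⟩, rfl⟩, mem_coneAt_of_add_smul_mem (hS.convex hσ) hwσ hε₃ hmem⟩

/-- Distinct cells through `w` have distinct cones at `w`. -/
theorem IsPolyhedralComplex.coneAt_injOn [Finite ι] (hS : IsPolyhedralComplex S)
    {σ τ : Set (ι → ℝ)} (hσ : σ ∈ S) (hτ : τ ∈ S) (hwσ : w ∈ σ) (hwτ : w ∈ τ)
    (h : coneAt w σ = coneAt w τ) : σ = τ := by
  have hface := hS.inter_face σ hσ τ hτ ⟨w, hwσ, hwτ⟩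
  have hmem := hS.inter_mem hσ hτ ⟨w, hwσ, hwτ⟩
  have hd : cellDim (σ ∩ τ) = cellDim σ := by
    rw [← cellDim_coneAt (hS.convex hmem) ⟨hwσ, hwτ⟩, ← cellDim_coneAt (hS.convex hσ) hwσ,
      coneAt_inter, ← h, Set.inter_self]
  have hd' : cellDim σ = cellDim τ := by
    rw [← cellDim_coneAt (hS.convex hσ) hwσ, h, cellDim_coneAt (hS.convex hτ) hwτ]
  rw [← hface.1.eq_of_cellDim_le hd.ge]
  exact hface.2.eq_of_cellDim_le (hd.trans hd').ge

end Star

/-! ### Local and global connectedness through codimension one -/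

section Connected

variable {ι : Type*} {S : Set (Set (ι → ℝ))}

/-- If a preconnected set `A` meets all facets, and any two facets that share a point of `A` are
joined by a path of facets, then all facets are: the class of the facets through a point of `A` is
locally constant. -/
theorem connectedThroughCodimOne_of_isPreconnected {A : Set (ι → ℝ)} (hA : IsPreconnected A)
    (hloc : ∀ x ∈ A, ∀ᶠ y in 𝓝 x, ∀ σ ∈ S, y ∈ σ → x ∈ σ)
    (hfacet : ∀ x ∈ A, ∃ σ, IsFacet S σ ∧ x ∈ σ)
    (hmeet : ∀ σ, IsFacet S σ → (σ ∩ A).Nonempty)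
    (hreach : ∀ x ∈ A, ∀ σ τ : {σ // IsFacet S σ}, x ∈ σ.1 → x ∈ τ.1 →
      (facetRidgeGraph S).Reachable σ τ)
    (hne : ∃ σ, IsFacet S σ) : ConnectedThroughCodimOne S := by
  obtain ⟨σ₀, hσ₀⟩ := hne
  rw [ConnectedThroughCodimOne, SimpleGraph.connected_iff]
  refine ⟨fun σ τ => ?_, ⟨σ₀, hσ₀⟩⟩
  obtain ⟨x, hxσ, hx⟩ := hmeet σ.1 σ.2
  obtain ⟨y, hyτ, hy⟩ := hmeet τ.1 τ.2
  refine hA.induction₂' (fun x y => ∀ σ τ : {σ // IsFacet S σ}, x ∈ σ.1 → y ∈ τ.1 →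
      (facetRidgeGraph S).Reachable σ τ) (fun x hx => ?_) (fun x y z hx hy hz h₁ h₂ σ τ hσ hτ => ?_)
    hx hy σ τ hxσ hyτ
  · filter_upwards [mem_nhdsWithin_of_mem_nhds (hloc x hx)] with y hy
    exact ⟨fun σ τ hσ hτ => hreach x hx σ τ hσ (hy τ.1 τ.2.1 hτ),
      fun σ τ hσ hτ => hreach x hx σ τ (hy σ.1 σ.2.1 hσ) hτ⟩
  · obtain ⟨ρ, hρ, hyρ⟩ := hfacet y hy
    exact (h₁ σ ⟨ρ, hρ⟩ hσ hyρ).trans (h₂ ⟨ρ, hρ⟩ τ hyρ hτ)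

/-- In a pure complex, the facets of the star at `w` are the cones of the facets through `w`. -/
theorem isFacet_starAt (hS : IsPolyhedralComplex S) (hpure : IsPure S) {w : ι → ℝ}
    {A : Set (ι → ℝ)} [Finite ι] :
    IsFacet (starAt S w) A ↔ ∃ σ, IsFacet S σ ∧ w ∈ σ ∧ coneAt w σ = A := by
  constructor
  · rintro ⟨⟨σ, ⟨hσ, hw⟩, rfl⟩, hmax⟩
    obtain ⟨τ, hτ, hστ⟩ := hpure σ hσ
    have := hmax _ ⟨τ, ⟨hτ.1, hστ hw⟩, rfl⟩
    rw [cellDim_coneAt (hS.convex hτ.1) (hστ hw), cellDim_coneAt (hS.convex hσ) hw] at this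
    exact ⟨σ, ⟨hσ, fun ρ hρ => (hτ.2 ρ hρ).trans this⟩, hw, rfl⟩
  · rintro ⟨σ, hσ, hw, rfl⟩
    refine ⟨⟨σ, ⟨hσ.1, hw⟩, rfl⟩, ?_⟩
    rintro _ ⟨τ, ⟨hτ, hwτ⟩, rfl⟩
    rw [cellDim_coneAt (hS.convex hτ) hwτ, cellDim_coneAt (hS.convex hσ.1) hw]
    exact hσ.2 τ hτ

/-- A path of facets in the star at `w` lifts to a path of facets through `w`. -/
theorem reachable_of_starAt [Finite ι] (hS : IsPolyhedralComplex S) (hpure : IsPure S) {w : ι → ℝ}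
    (hstar : ConnectedThroughCodimOne (starAt S w)) (σ τ : {σ // IsFacet S σ})
    (hσ : w ∈ σ.1) (hτ : w ∈ τ.1) : (facetRidgeGraph S).Reachable σ τ := by
  have hlift : ∀ A : {A // IsFacet (starAt S w) A}, ∃ σ : {σ // IsFacet S σ},
      w ∈ σ.1 ∧ coneAt w σ.1 = A.1 := fun A => by
    obtain ⟨σ, hσ, h⟩ := (isFacet_starAt hS hpure).1 A.2
    exact ⟨⟨σ, hσ⟩, h⟩
  choose f hfw hf using hlift
  have hfc : ∀ σ : {σ // IsFacet S σ}, ∀ hσ : w ∈ σ.1,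
      f ⟨coneAt w σ.1, (isFacet_starAt hS hpure).2 ⟨σ, σ.2, hσ, rfl⟩⟩ = σ := fun σ hσ =>
    Subtype.ext (hS.coneAt_injOn (f _).2.1 σ.2.1 (hfw _) hσ (hf _))
  let φ : facetRidgeGraph (starAt S w) →g facetRidgeGraph S :=
    { toFun := f
      map_rel' := by
        rintro A B ⟨hAB, hridge, C, hC, hdim⟩
        have hmem := hS.inter_mem (f A).2.1 (f B).2.1 ⟨w, hfw A, hfw B⟩
        refine ⟨fun h => hAB (Subtype.ext ?_), hmem, f A, (f A).2, ?_⟩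
        · rw [← hf A, ← hf B, h]
        · have h₁ : cellDim C = cellDim A.1 := le_antisymm (A.2.2 C hC.1) (hC.2 A.1 A.2.1)
          rw [← hf A, ← hf B, ← coneAt_inter,
            cellDim_coneAt (hS.convex hmem) ⟨hfw A, hfw B⟩] at hdim
          rw [hdim, h₁, ← hf A, cellDim_coneAt (hS.convex (f A).2.1) (hfw A)] }
  have := (hstar.preconnected ⟨coneAt w σ.1, (isFacet_starAt hS hpure).2 ⟨σ, σ.2, hσ, rfl⟩⟩
    ⟨coneAt w τ.1, (isFacet_starAt hS hpure).2 ⟨τ, τ.2, hτ, rfl⟩⟩).map φ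
  rwa [show φ _ = σ from hfc σ hσ, show φ _ = τ from hfc τ hτ] at this

/-- Connectedness through codimension one is a local property of a connected pure complex. -/
theorem connectedThroughCodimOne_of_locally [Finite ι] (hS : IsPolyhedralComplex S)
    (hconn : IsConnected (support S)) (hpure : IsPure S)
    (hlocal : LocallyConnectedThroughCodimOne S) : ConnectedThroughCodimOne S := by
  have hfacet : ∀ x ∈ support S, ∃ σ, IsFacet S σ ∧ x ∈ σ := by
    rintro x ⟨σ, hσ, hx⟩
    obtain ⟨τ, hτ, hστ⟩ := hpure σ hσ
    exact ⟨τ, hτ, hστ hx⟩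
  refine connectedThroughCodimOne_of_isPreconnected hconn.isPreconnected
    (fun x hx => hS.eventually_mem hx) hfacet (fun σ hσ => ?_)
    (fun x hx σ τ hσ hτ => reachable_of_starAt hS hpure (hlocal x hx) σ τ hσ hτ) ?_
  · obtain ⟨x, hx⟩ := hS.nonempty σ hσ.1
    exact ⟨x, hx, σ, hσ.1, hx⟩
  · obtain ⟨x, hx⟩ := hconn.nonempty
    obtain ⟨σ, hσ, -⟩ := hfacet x hx
    exact ⟨σ, hσ⟩

end Connected

/-! ### Tropical manifolds -/

section Manifold

variable {ι : Type*} {S : Set (Set (ι → ℝ))} {w : ι → ℝ} {d : ℕ}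

theorem finite_spans_starAt (hS : IsPolyhedralComplex S) (w : ι → ℝ) (p : Set (ι → ℝ) → Prop) :
    ((fun σ => Submodule.span ℝ (coneAt w σ)) '' {σ | (σ ∈ S ∧ w ∈ σ) ∧ p σ}).Finite :=
  ((hS.finite_mem w).subset fun _ h => h.1).image _

theorem HasDim.unique {S : Set (Set (ι → ℝ))} {d d' : ℕ} (h : HasDim S d) (h' : HasDim S d') :
    d = d' := by
  obtain ⟨⟨σ, hσ, rfl⟩, hle⟩ := h
  obtain ⟨⟨τ, hτ, rfl⟩, hle'⟩ := h'
  exact le_antisymm (hle' σ hσ) (hle τ hτ)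

theorem support_starAt_nonempty (hw : w ∈ support S) : (support (starAt S w)).Nonempty := by
  obtain ⟨σ, hσ, hwσ⟩ := hw
  exact ⟨0, _, ⟨σ, ⟨hσ, hwσ⟩, rfl⟩, zero_mem_coneAt hwσ⟩

variable [Finite ι]

/-- If the support of the star at `w` is a connected fan of dimension `d`, then all cells through
`w` have dimension at most `d`. -/
theorem cellDim_le_of_isConnectedFan (hS : IsPolyhedralComplex S)
    (hfan : IsConnectedFan d (support (starAt S w))) {σ : Set (ι → ℝ)} (hσ : σ ∈ S) (hw : w ∈ σ) :
    cellDim σ ≤ d := by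
  obtain ⟨Z, hZ, hZd, hcov⟩ := hfan.cover
  have hsub : coneAt w σ ⊆ unionOf Z :=
    fun v hv => hcov ⟨_, ⟨σ, ⟨hσ, hw⟩, rfl⟩, hv⟩
  obtain ⟨W, hW, hσW⟩ := exists_subset_of_convex_of_subset_unionOf
    (convex_coneAt (hS.convex hσ)) ⟨0, zero_mem_coneAt hw⟩ hZ hsub
  rw [← finrank_span_coneAt (hS.convex hσ) hw]
  exact (Submodule.finrank_mono (Submodule.span_le.2 hσW)).trans (hZd W hW)

/-- If the support of the star at `w` is a connected fan of dimension `d`, then every cell through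
`w` lies in a `d`-dimensional cell. -/
theorem exists_superset_of_isConnectedFan (hS : IsPolyhedralComplex S)
    (hfan : IsConnectedFan d (support (starAt S w))) {τ : Set (ι → ℝ)} (hτ : τ ∈ S) (hw : w ∈ τ) :
    ∃ σ ∈ S, τ ⊆ σ ∧ cellDim σ = d := by
  obtain ⟨z, hz⟩ := (hS.isPolyhedron τ hτ).exists_isRelInteriorPoint ⟨w, hw⟩
  have hzcone : z - w ∈ coneAt w τ :=
    mem_coneAt_of_add_smul_mem (hS.convex hτ) hw one_pos (by simpa using hz.1)
  -- the cones of dimension less than `d` do not matter for the closure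
  have hcl := hfan.dense _ (finite_spans_starAt hS w (fun σ => cellDim σ < d)) (by
    rintro _ ⟨σ, ⟨⟨hσ, hwσ⟩, hd⟩, rfl⟩
    rwa [finrank_span_coneAt (hS.convex hσ) hwσ]) ⟨_, ⟨τ, ⟨hτ, hw⟩, rfl⟩, hzcone⟩
  have hfin : {σ | (σ ∈ S ∧ w ∈ σ) ∧ d ≤ cellDim σ}.Finite :=
    (hS.finite_mem w).subset fun _ h => h.1
  have hclosed : IsClosed (⋃ σ ∈ {σ | (σ ∈ S ∧ w ∈ σ) ∧ d ≤ cellDim σ}, coneAt w σ) :=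
    hfin.isClosed_biUnion fun σ hσ => (hS.isPolyhedron σ hσ.1.1).isClosed_coneAt hσ.1.2
  have hmem := closure_minimal (t := ⋃ σ ∈ {σ | (σ ∈ S ∧ w ∈ σ) ∧ d ≤ cellDim σ}, coneAt w σ)
    (by
      rintro v ⟨⟨_, ⟨σ, hσ, rfl⟩, hv⟩, hvZ⟩
      refine Set.mem_biUnion (x := σ) ⟨hσ, not_lt.1 fun hlt => hvZ ?_⟩ hv
      exact mem_unionOf.2 ⟨_, ⟨σ, ⟨hσ, hlt⟩, rfl⟩, Submodule.subset_span hv⟩) hclosed hcl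
  obtain ⟨σ, ⟨⟨hσ, hwσ⟩, hd⟩, hzσ⟩ := Set.mem_iUnion₂.1 hmem
  obtain ⟨ε, h0, h1, hε⟩ := exists_add_smul_mem hzσ
  have hface := (hS.inter_face σ hσ τ hτ ⟨w, hwσ, hw⟩).2
  have hετ : w + ε • (z - w) ∈ τ := (hS.convex hτ).add_smul_sub_mem hw hz.1 ⟨h0.le, h1.le⟩
  have hzF : z ∈ σ ∩ τ := hface.mem_of_add_smul_mem hw hz.1 h0 h1 ⟨hε, hετ⟩
  exact ⟨σ, hσ, Set.inter_eq_right.1 (hface.eq_of_isRelInteriorPoint hz hzF),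
    le_antisymm (cellDim_le_of_isConnectedFan hS hfan hσ hwσ) hd⟩

theorem hasDim_starAt_of_isConnectedFan (hS : IsPolyhedralComplex S) (hw : w ∈ support S)
    (hfan : IsConnectedFan d (support (starAt S w))) : HasDim (starAt S w) d := by
  obtain ⟨τ, hτ, hwτ⟩ := hw
  obtain ⟨σ, hσ, hτσ, hd⟩ := exists_superset_of_isConnectedFan hS hfan hτ hwτ
  refine ⟨⟨_, ⟨σ, ⟨hσ, hτσ hwτ⟩, rfl⟩, ?_⟩, ?_⟩
  · rw [cellDim_coneAt (hS.convex hσ) (hτσ hwτ), hd]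
  · rintro _ ⟨ρ, ⟨hρ, hwρ⟩, rfl⟩
    rw [cellDim_coneAt (hS.convex hρ) hwρ]
    exact cellDim_le_of_isConnectedFan hS hfan hρ hwρ

/-- If the support of the star at `w` is a connected fan, then the star is connected through
codimension one: away from the cones of codimension at least two, two facets that share a point
intersect in a ridge. -/
theorem connectedThroughCodimOne_starAt (hS : IsPolyhedralComplex S) (hw : w ∈ support S)
    (hfan : IsConnectedFan d (support (starAt S w))) : ConnectedThroughCodimOne (starAt S w) := by
  have hdim := hasDim_starAt_of_isConnectedFan hS hw hfan
  have hfacet : ∀ A, IsFacet (starAt S w) A ↔ A ∈ starAt S w ∧ cellDim A = d := by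
    intro A
    constructor
    · rintro ⟨hA, hmax⟩
      obtain ⟨B, hB, hBd⟩ := hdim.1
      exact ⟨hA, le_antisymm (hdim.2 A hA) (hBd ▸ hmax B hB)⟩
    · rintro ⟨hA, hAd⟩
      exact ⟨hA, fun B hB => hAd ▸ hdim.2 B hB⟩
  set Z := (fun σ => Submodule.span ℝ (coneAt w σ)) ''
    {σ | (σ ∈ S ∧ w ∈ σ) ∧ cellDim σ + 2 ≤ d} with hZdef
  have hZ : Z.Finite := finite_spans_starAt hS w _
  have hZd : ∀ W ∈ Z, Module.finrank ℝ W + 2 ≤ d := by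
    rintro _ ⟨σ, ⟨⟨hσ, hwσ⟩, hd⟩, rfl⟩
    rwa [finrank_span_coneAt (hS.convex hσ) hwσ]
  refine connectedThroughCodimOne_of_isPreconnected (hfan.preconnected Z hZ hZd)
    (fun x hx => ?_) (fun x hx => ?_) (fun A hA => ?_) (fun x hx A B hxA hxB => ?_) ?_
  · have hfin : (starAt S w).Finite := (hS.finite_mem w).image _
    rw [Filter.eventually_all_finite hfin]
    rintro _ ⟨σ, hσ, rfl⟩
    by_cases hxσ : x ∈ coneAt w σ
    · exact Filter.Eventually.of_forall fun _ _ => hxσ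
    · filter_upwards [((hS.isPolyhedron σ hσ.1).isClosed_coneAt
        hσ.2).isOpen_compl.mem_nhds hxσ] with y hy hyσ
      exact absurd hyσ hy
  · obtain ⟨⟨_, ⟨τ, ⟨hτ, hwτ⟩, rfl⟩, hxτ⟩, -⟩ := hx
    obtain ⟨σ, hσ, hτσ, hd⟩ := exists_superset_of_isConnectedFan hS hfan hτ hwτ
    exact ⟨coneAt w σ, (hfacet _).2 ⟨⟨σ, ⟨hσ, hτσ hwτ⟩, rfl⟩,
      by rw [cellDim_coneAt (hS.convex hσ) (hτσ hwτ), hd]⟩, coneAt_mono hτσ hxτ⟩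
  · obtain ⟨⟨σ, ⟨hσ, hwσ⟩, rfl⟩, hd⟩ := (hfacet A).1 hA
    rw [cellDim_coneAt (hS.convex hσ) hwσ] at hd
    by_contra hempty
    have hsub : coneAt w σ ⊆ unionOf Z := fun v hv => by_contra fun hvZ =>
      hempty ⟨v, hv, ⟨_, ⟨σ, ⟨hσ, hwσ⟩, rfl⟩, hv⟩, hvZ⟩
    obtain ⟨W, hW, hσW⟩ := exists_subset_of_convex_of_subset_unionOf
      (convex_coneAt (hS.convex hσ)) ⟨0, zero_mem_coneAt hwσ⟩ hZ hsub
    have h₁ := Submodule.finrank_mono (Submodule.span_le.2 hσW)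
    rw [finrank_span_coneAt (hS.convex hσ) hwσ] at h₁
    have := hZd W hW
    omega
  · by_cases hAB : A = B
    · rw [hAB]
    refine SimpleGraph.Adj.reachable ⟨hAB, ?_⟩
    have hAB' : A.1 ≠ B.1 := fun h => hAB (Subtype.ext h)
    obtain ⟨A, hA⟩ := A
    obtain ⟨B, hB⟩ := B
    obtain ⟨⟨σ, ⟨hσ, hwσ⟩, rfl⟩, hσd⟩ := (hfacet A).1 hA
    obtain ⟨⟨τ, ⟨hτ, hwτ⟩, rfl⟩, hτd⟩ := (hfacet B).1 hB
    have hmem := hS.inter_mem hσ hτ ⟨w, hwσ, hwτ⟩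
    have hface := hS.inter_face σ hσ τ hτ ⟨w, hwσ, hwτ⟩
    refine ⟨⟨σ ∩ τ, ⟨hmem, hwσ, hwτ⟩, coneAt_inter⟩, _, hA, ?_⟩
    rw [← coneAt_inter, cellDim_coneAt (hS.convex hmem) ⟨hwσ, hwτ⟩, hσd]
    rw [cellDim_coneAt (hS.convex hσ) hwσ] at hσd
    rw [cellDim_coneAt (hS.convex hτ) hwτ] at hτd
    have hlt : cellDim (σ ∩ τ) < d := by
      by_contra! hge
      have h₁ := hface.1.eq_of_cellDim_le (hσd.le.trans hge)
      have h₂ := hface.2.eq_of_cellDim_le (hτd.le.trans hge)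
      exact hAB' (congrArg (coneAt w) (h₁.symm.trans h₂))
    have hge : ¬ cellDim (σ ∩ τ) + 2 ≤ d := fun h => hx.2 (mem_unionOf.2
      ⟨_, ⟨σ ∩ τ, ⟨⟨hmem, hwσ, hwτ⟩, h⟩, rfl⟩, Submodule.subset_span (by
        rw [coneAt_inter]; exact ⟨hxA, hxB⟩)⟩)
    omega
  · obtain ⟨A, hA, hd⟩ := hdim.1
    exact ⟨A, (hfacet A).2 ⟨hA, hd⟩⟩

theorem IsTropicalManifold.isConnectedFan (h : IsTropicalManifold d S) (hw : w ∈ support S) :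
    IsConnectedFan d (support (starAt S w)) := by
  obtain ⟨m, M, -, hM⟩ := h.star_iso w hw
  obtain ⟨d', hd'⟩ := isConnectedFan_of_linearlyIsomorphic (support_starAt_nonempty hw) hM
  rwa [(h.hasDim_star w hw).unique
    (hasDim_starAt_of_isConnectedFan h.isPolyhedralComplex hw hd')]

theorem IsTropicalManifold.connectedThroughCodimOne (h : IsTropicalManifold d S)
    (hconn : IsConnected (support S)) : ConnectedThroughCodimOne S := by
  have hS := h.isPolyhedralComplex
  refine connectedThroughCodimOne_of_locally hS hconn (fun τ hτ => ?_)
    (fun w hw => connectedThroughCodimOne_starAt hS hw (h.isConnectedFan hw))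
  obtain ⟨w, hw⟩ := hS.nonempty τ hτ
  obtain ⟨σ, hσ, hτσ, hd⟩ :=
    exists_superset_of_isConnectedFan hS (h.isConnectedFan ⟨τ, hτ, hw⟩) hτ hw
  refine ⟨σ, ⟨hσ, fun ρ hρ => ?_⟩, hτσ⟩
  obtain ⟨v, hv⟩ := hS.nonempty ρ hρ
  rw [hd]
  exact cellDim_le_of_isConnectedFan hS (h.isConnectedFan ⟨ρ, hρ, hv⟩) hρ hv

end Manifold

/-! ### Complexes from hyperplane arrangements -/

section Arrangement

variable {ι K : Type*} (l : K → (ι → ℝ) →ₗ[ℝ] ℝ) (c : K → ℝ)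

/-- The closed cell of `x` in the arrangement of the hyperplanes `l k = c k`: the points that
satisfy all weak inequalities between `l k` and `c k` that hold at `x`. -/
def signCell (x : ι → ℝ) : Set (ι → ℝ) :=
  {y | ∀ k, (l k x ≤ c k → l k y ≤ c k) ∧ (c k ≤ l k x → c k ≤ l k y)}

variable {l c}

theorem self_mem_signCell (x : ι → ℝ) : x ∈ signCell l c x := fun _ => ⟨id, id⟩

theorem isPolyhedron_signCell [Finite K] (x : ι → ℝ) : IsPolyhedron (signCell l c x) := by
  have hfin : {a : ((ι → ℝ) →ₗ[ℝ] ℝ) × ℝ | ∃ k, (l k x ≤ c k ∧ a = (l k, c k)) ∨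
      (c k ≤ l k x ∧ a = (-l k, -c k))}.Finite := by
    refine ((Set.finite_range fun k => (l k, c k)).union
      (Set.finite_range fun k => (-l k, -c k))).subset ?_
    rintro a ⟨k, ⟨-, rfl⟩ | ⟨-, rfl⟩⟩
    · exact Or.inl ⟨k, rfl⟩
    · exact Or.inr ⟨k, rfl⟩
  refine ⟨hfin.toFinset, Set.ext fun y =>
    ⟨fun hy a ha => ?_, fun hy k => ⟨fun hk => ?_, fun hk => ?_⟩⟩⟩
  · obtain ⟨k, ⟨hk, rfl⟩ | ⟨hk, rfl⟩⟩ := hfin.mem_toFinset.1 ha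
    · exact (hy k).1 hk
    · exact neg_le_neg ((hy k).2 hk)
  · exact hy (l k, c k) (hfin.mem_toFinset.2 ⟨k, Or.inl ⟨hk, rfl⟩⟩)
  · exact neg_le_neg_iff.1 (hy (-l k, -c k) (hfin.mem_toFinset.2 ⟨k, Or.inr ⟨hk, rfl⟩⟩))

theorem IsFace.isPolyhedron {F P : Set (ι → ℝ)} (h : IsFace F P) (hP : IsPolyhedron P) :
    IsPolyhedron F := by
  classical
  obtain ⟨y, hy⟩ := h.1
  obtain ⟨φ, rfl⟩ := h.exists_linear
  obtain ⟨s, rfl⟩ := hP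
  refine ⟨insert (-φ, -φ y) s, Set.ext fun x => ⟨fun hx a ha => ?_, fun hx => ⟨fun a ha =>
    hx a (Finset.mem_insert_of_mem ha), fun z hz => (hy.2 z hz).trans ?_⟩⟩⟩
  · rcases Finset.mem_insert.1 ha with rfl | ha
    · exact neg_le_neg (hx.2 y hy.1)
    · exact hx.1 a ha
  · exact neg_le_neg_iff.1 (hx _ (Finset.mem_insert_self _ _))

/-- A face of a cell is the cell of any of its relative interior points. -/
theorem IsFace.eq_signCell [Finite K] {F : Set (ι → ℝ)} {x : ι → ℝ}
    (h : IsFace F (signCell l c x)) : ∃ z ∈ signCell l c x, F = signCell l c z := by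
  obtain ⟨z, hz⟩ := (h.isPolyhedron (isPolyhedron_signCell x)).exists_isRelInteriorPoint h.1
  have hzx := h.subset hz.1
  refine ⟨z, hzx, Set.Subset.antisymm (fun y hy k => ?_) fun y hy => ?_⟩
  · obtain ⟨δ, hδ, hmem⟩ := hz.2 y hy
    have h₁ := h.subset hy k
    have h₂ := h.subset hmem k
    have h₃ := hzx k
    simp only [map_sub, map_smul, smul_eq_mul] at h₂
    constructor
    · intro hk
      rcases le_total (l k x) (c k) with hx | hx
      · exact h₁.1 hx
      · have := h₂.2 hx
        by_contra! hlt
        nlinarith [h₃.2 hx]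
    · intro hk
      rcases le_total (l k x) (c k) with hx | hx
      · have := h₂.1 hx
        by_contra! hlt
        nlinarith [h₃.1 hx]
      · exact h₁.2 hx
  · -- some prolongation of the segment from `y` to `z` stays in the cell of `x`
    have hev : ∀ᶠ δ in 𝓝[>] (0 : ℝ), z - δ • (y - z) ∈ signCell l c x := by
      have hk : ∀ k, ∀ᶠ δ in 𝓝[>] (0 : ℝ), (l k x ≤ c k → l k (z - δ • (y - z)) ≤ c k) ∧
          (c k ≤ l k x → c k ≤ l k (z - δ • (y - z))) := by
        intro k
        simp only [map_sub, map_smul, smul_eq_mul]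
        have hcont : Filter.Tendsto (fun δ : ℝ => l k z - δ * (l k y - l k z)) (𝓝[>] 0)
            (𝓝 (l k z - 0 * (l k y - l k z))) :=
          (Continuous.tendsto (by fun_prop) 0).mono_left nhdsWithin_le_nhds
        rw [zero_mul, sub_zero] at hcont
        rcases lt_trichotomy (l k z) (c k) with hlt | heq | hlt
        · filter_upwards [hcont.eventually_lt_const hlt] with δ hδ
          exact ⟨fun _ => hδ.le, fun hx => absurd ((hzx k).2 hx) hlt.not_ge⟩
        · have hy' : l k y = c k := le_antisymm ((hy k).1 heq.le) ((hy k).2 heq.ge)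
          refine Filter.Eventually.of_forall fun δ => ?_
          rw [heq, hy', sub_self, mul_zero, sub_zero]
          exact ⟨fun _ => le_rfl, fun _ => le_rfl⟩
        · filter_upwards [hcont.eventually_const_lt hlt] with δ hδ
          exact ⟨fun hx => absurd ((hzx k).1 hx) hlt.not_ge, fun _ => hδ.le⟩
      exact (Filter.eventually_all.2 hk).mono fun δ hδ => hδ
    have hyx : y ∈ signCell l c x := fun k =>
      ⟨fun hx => (hy k).1 ((hzx k).1 hx), fun hx => (hy k).2 ((hzx k).2 hx)⟩
    obtain ⟨δ, hδ, hδ0⟩ := (hev.and self_mem_nhdsWithin).exists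
    change 0 < δ at hδ0
    obtain ⟨φ, hφ⟩ := h.exists_linear
    have hzF := hz.1
    rw [hφ] at hzF ⊢
    refine ⟨hyx, fun p hp => (hzF.2 p hp).trans ?_⟩
    have := hzF.2 _ hδ
    simp only [map_sub, map_smul, smul_eq_mul] at this
    nlinarith

theorem isFace_signCell_inter [Finite ι] [Finite K] {x x' : ι → ℝ}
    (hne : (signCell l c x ∩ signCell l c x').Nonempty) :
    IsFace (signCell l c x ∩ signCell l c x') (signCell l c x) := by
  classical
  have := Fintype.ofFinite K
  -- the hyperplanes to which the second cell restricts the first cell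
  let a : K → ℝ := fun k => if l k x < c k ∧ c k ≤ l k x' then 1 else
    if c k < l k x ∧ l k x' ≤ c k then -1 else 0
  have ha : ∀ y ∈ signCell l c x, ∀ k, a k * (l k y - c k) ≤ 0 := by
    intro y hy k
    simp only [a]
    split_ifs with h₁ h₂
    · linarith [(hy k).1 h₁.1.le]
    · linarith [(hy k).2 h₂.1.le]
    · simp
  have ha' : ∀ y ∈ signCell l c x, (y ∈ signCell l c x' ↔ ∀ k, a k * (l k y - c k) = 0) := by
    intro y hy
    refine forall_congr' fun k => ?_
    have hyk := hy k
    simp only [a]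
    split_ifs with h₁ h₂
    · have := hyk.1 h₁.1.le
      constructor
      · intro h; linarith [h.2 h₁.2]
      · intro h; exact ⟨fun _ => this, fun _ => by linarith⟩
    · have := hyk.2 h₂.1.le
      constructor
      · intro h; linarith [h.1 h₂.2]
      · intro h; exact ⟨fun _ => by linarith, fun _ => this⟩
    · simp only [zero_mul, iff_true]
      rw [not_and_or, not_lt, not_le] at h₁ h₂
      constructor
      · intro hk
        rcases h₂ with h | h
        · exact hyk.1 h
        · exact absurd hk h.not_ge
      · intro hk
        rcases h₁ with h | h
        · exact hyk.2 h
        · exact absurd hk h.not_ge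
  let φ : (ι → ℝ) →ₗ[ℝ] ℝ := ∑ k, a k • l k
  have hφ : ∀ y, φ y = ∑ k, a k * (l k y - c k) + ∑ k, a k * c k := by
    intro y
    simp only [φ, LinearMap.sum_apply, LinearMap.smul_apply, smul_eq_mul, mul_sub,
      Finset.sum_sub_distrib, sub_add_cancel]
  refine ⟨hne, fun _ => ⟨LinearMap.toContinuousLinearMap φ, ?_⟩⟩
  change _ = {z ∈ signCell l c x | ∀ y ∈ signCell l c x, φ y ≤ φ z}
  ext z
  constructor
  · rintro ⟨hz, hz'⟩
    refine ⟨hz, fun y hy => ?_⟩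
    rw [hφ, hφ, Finset.sum_eq_zero fun k _ => (ha' z hz).1 hz' k]
    gcongr
    exact Finset.sum_nonpos fun k _ => ha y hy k
  · rintro ⟨hz, hmax⟩
    obtain ⟨y, hy, hy'⟩ := hne
    have h₁ := hmax y hy
    rw [hφ, hφ, Finset.sum_eq_zero fun k _ => (ha' y hy).1 hy' k] at h₁
    have h₂ : ∑ k, a k * (l k z - c k) = 0 :=
      le_antisymm (Finset.sum_nonpos fun k _ => ha z hz k) (by linarith)
    refine ⟨hz, (ha' z hz).2 fun k => ?_⟩
    exact (Finset.sum_eq_zero_iff_of_nonpos fun k _ => ha z hz k).1 h₂ k (Finset.mem_univ _)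

/-- A set that contains the closed cell of each of its points in a finite hyperplane arrangement is
the support of a finite polyhedral complex. -/
theorem exists_isPolyhedralComplex_of_signCell_subset [Finite ι] [Finite K] {X : Set (ι → ℝ)}
    (hX : ∀ x ∈ X, signCell l c x ⊆ X) :
    ∃ S, S.Finite ∧ IsPolyhedralComplex S ∧ support S = X := by
  have hfin : (signCell l c '' X).Finite := by
    let G : (K → Prop × Prop) → Set (ι → ℝ) := fun p =>
      {y | ∀ k, ((p k).1 → l k y ≤ c k) ∧ ((p k).2 → c k ≤ l k y)}
    refine (Set.finite_range G).subset ?_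
    rintro _ ⟨x, -, rfl⟩
    exact ⟨fun k => (l k x ≤ c k, c k ≤ l k x), rfl⟩
  refine ⟨signCell l c '' X, hfin, ⟨?_, ?_, ?_, ?_, ?_⟩, ?_⟩
  · rintro _ ⟨x, -, rfl⟩
    exact isPolyhedron_signCell x
  · rintro _ ⟨x, -, rfl⟩
    exact ⟨x, self_mem_signCell x⟩
  · rintro _ ⟨x, hx, rfl⟩ F hF
    obtain ⟨z, hz, rfl⟩ := hF.eq_signCell
    exact ⟨z, hX x hx hz, rfl⟩
  · rintro _ ⟨x, -, rfl⟩ _ ⟨y, -, rfl⟩ hne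
    refine ⟨isFace_signCell_inter hne, ?_⟩
    rw [Set.inter_comm] at hne ⊢
    exact isFace_signCell_inter hne
  · intro x _
    exact ⟨Set.univ, Filter.univ_mem, hfin.subset fun σ hσ => hσ.1⟩
  · refine Set.Subset.antisymm ?_ fun x hx => ⟨_, ⟨x, hx, rfl⟩, self_mem_signCell x⟩
    rintro y ⟨_, ⟨x, hx, rfl⟩, hy⟩
    exact hX x hx hy

end Arrangement

/-! ### Valuated matroids in additive notation -/

section VectorFamily

variable {ι : Type*}

/-- The vectors of a valuated matroid in `(ℝ ∪ {∞})^ι`, in additive notation: a set that is closed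
under adding real constants and satisfies vector elimination. Closure under minima is not needed. -/
structure IsVectorFamily (V : Set (ι → WithTop ℝ)) : Prop where
  add_const : ∀ v ∈ V, ∀ c : ℝ, (fun i => v i + (c : WithTop ℝ)) ∈ V
  elim : ∀ G ∈ V, ∀ H ∈ V, ∀ e, G e = H e → ∃ F ∈ V, F e = ⊤ ∧
    ∀ i, i ≠ e → min (G i) (H i) ≤ F i ∧ (G i ≠ H i → F i = min (G i) (H i))

/-- The set of indices at which the minimum of `v i + x i` is attained, if it is finite. -/
def initForm (v : ι → WithTop ℝ) (x : ι → ℝ) : Set ι :=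
  {i | v i ≠ ⊤ ∧ ∀ k, v i + x i ≤ v k + x k}

/-- The points `x` of `ℝ^ι` at which the minimum of `v i + x i` is `∞` or attained twice, for all
`v` in `V`. -/
def tropSet (V : Set (ι → WithTop ℝ)) : Set (ι → ℝ) :=
  {x | ∀ v ∈ V, (∃ i, v i ≠ ⊤) → (initForm v x).Nontrivial}

theorem mem_initForm {v : ι → WithTop ℝ} {x : ι → ℝ} {i : ι} :
    i ∈ initForm v x ↔ ∃ a : ℝ, v i = a ∧ ∀ k (b : ℝ), v k = b → a + x i ≤ b + x k := by
  constructor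
  · rintro ⟨hi, hle⟩
    obtain ⟨a, ha⟩ := WithTop.ne_top_iff_exists.1 hi
    refine ⟨a, ha.symm, fun k b hb => ?_⟩
    have := hle k
    rw [← ha, hb] at this
    exact_mod_cast this
  · rintro ⟨a, ha, hle⟩
    refine ⟨by simp [ha], fun k => ?_⟩
    rcases eq_or_ne (v k) ⊤ with hk | hk
    · simp [hk]
    · obtain ⟨b, hb⟩ := WithTop.ne_top_iff_exists.1 hk
      rw [ha, ← hb]
      exact_mod_cast hle k b hb.symm

theorem initForm_add_const (v : ι → WithTop ℝ) (c : ℝ) (x : ι → ℝ) :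
    initForm (fun i => v i + (c : WithTop ℝ)) x = initForm v x := by
  have key : ∀ (v : ι → WithTop ℝ) (c : ℝ),
      initForm v x ⊆ initForm (fun i => v i + (c : WithTop ℝ)) x := by
    intro v c i hi
    obtain ⟨a, ha, hle⟩ := mem_initForm.1 hi
    refine mem_initForm.2 ⟨a + c, by simp [ha], fun k b hb => ?_⟩
    have hk : v k ≠ ⊤ := by rintro h; simp [h] at hb
    obtain ⟨b', hb'⟩ := WithTop.ne_top_iff_exists.1 hk
    have h₁ := hle k b' hb'.symm
    have h₂ : b' + c = b := by
      rw [← hb'] at hb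
      exact_mod_cast hb
    linarith
  refine Set.Subset.antisymm ?_ (key v c)
  have h := key (fun i => v i + (c : WithTop ℝ)) (-c)
  have hv : (fun i => v i + (c : WithTop ℝ) + ((-c : ℝ) : WithTop ℝ)) = v := by
    funext i
    rw [add_assoc, ← WithTop.coe_add, add_neg_cancel, WithTop.coe_zero, add_zero]
  rwa [hv] at h

theorem initForm_nonempty [Finite ι] {v : ι → WithTop ℝ} (hv : ∃ i, v i ≠ ⊤) (x : ι → ℝ) :
    (initForm v x).Nonempty := by
  obtain ⟨i₀, hi₀⟩ := hv
  obtain ⟨i, -, hi⟩ := Set.exists_min_image Set.univ (fun i => v i + (x i : WithTop ℝ))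
    (Set.toFinite _) ⟨i₀, Set.mem_univ _⟩
  refine ⟨i, fun h => ?_, fun k => hi k (Set.mem_univ _)⟩
  have := hi i₀ (Set.mem_univ _)
  rw [h, top_add, top_le_iff] at this
  simp [hi₀] at this

/-- The initial forms at `w` of the vectors of a valuated matroid. -/
def initFamily (V : Set (ι → WithTop ℝ)) (w : ι → ℝ) : Set (Set ι) :=
  {S | ∃ v ∈ V, (∃ i, v i ≠ ⊤) ∧ S = initForm v w}

/-- Vector elimination in a valuated matroid induces strong circuit elimination for the initial
forms. -/
theorem IsVectorFamily.isElimFamily [Finite ι] {V : Set (ι → WithTop ℝ)} (hV : IsVectorFamily V)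
    (w : ι → ℝ) : IsElimFamily (initFamily V w) where
  nonempty := by
    rintro _ ⟨v, -, hv, rfl⟩
    exact initForm_nonempty hv w
  elim := by
    rintro _ ⟨G, hG, -, rfl⟩ _ ⟨H, hH, -, rfl⟩ e heG heH f hfG hfH
    obtain ⟨a, ha, haG⟩ := mem_initForm.1 heG
    -- rescale the second vector so that the two agree at `e`
    obtain ⟨H', hH', hHe, hHinit⟩ : ∃ H' ∈ V, H' e = a ∧ initForm H' w = initForm H w := by
      obtain ⟨b, hb, -⟩ := mem_initForm.1 heH
      refine ⟨_, hV.add_const H hH (a - b), ?_, initForm_add_const H _ w⟩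
      rw [hb]
      exact_mod_cast add_sub_cancel b a
    rw [← hHinit] at heH hfH ⊢
    clear hHinit hH
    have haH : ∀ k (b : ℝ), H' k = b → a + w e ≤ b + w k := by
      obtain ⟨a', ha', h⟩ := mem_initForm.1 heH
      have : a' = a := by rw [hHe] at ha'; exact_mod_cast ha'.symm
      exact this ▸ h
    obtain ⟨F, hF, hFe, hFle⟩ := hV.elim G hG H' hH' e (ha.trans hHe.symm)
    have hfe : f ≠ e := fun h => hfH (h ▸ heH)
    obtain ⟨g, hg, hgG⟩ := mem_initForm.1 hfG
    have hgm : g + w f = a + w e := le_antisymm (hgG e a ha) (haG f g hg)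
    have hlt : G f < H' f := by
      by_contra! hle
      rw [hg] at hle
      obtain ⟨h, hh⟩ := WithTop.ne_top_iff_exists.1 (hle.trans_lt (WithTop.coe_lt_top g)).ne
      rw [← hh] at hle
      have hle' : h ≤ g := by exact_mod_cast hle
      refine hfH (mem_initForm.2 ⟨h, hh.symm, fun k b hb => ?_⟩)
      linarith [haH k b hb]
    have hFf : F f = g := by
      rw [(hFle f hfe).2 hlt.ne, min_eq_left hlt.le, hg]
    -- every finite coordinate of `F` dominates that of `G` or of `H'`
    have hdom : ∀ k (b : ℝ), F k = b → (∃ b' ≤ b, G k = b') ∨ ∃ b' ≤ b, H' k = b' := by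
      intro k b hb
      have hke : k ≠ e := by rintro rfl; rw [hFe] at hb; exact WithTop.top_ne_coe hb
      have hle := (hFle k hke).1
      rw [hb, min_le_iff] at hle
      refine hle.imp (fun h => ?_) (fun h => ?_)
      all_goals
        obtain ⟨b', hb'⟩ := WithTop.ne_top_iff_exists.1 (h.trans_lt (WithTop.coe_lt_top b)).ne
        rw [← hb'] at h
        exact ⟨b', by exact_mod_cast h, hb'.symm⟩
    refine ⟨initForm F w, ⟨F, hF, ⟨f, by simp [hFf]⟩, rfl⟩, mem_initForm.2 ⟨g, hFf, ?_⟩, ?_,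
      fun h => h.1 hFe⟩
    · intro k b hb
      rcases hdom k b hb with ⟨b', hle, hb'⟩ | ⟨b', hle, hb'⟩
      · linarith [haG k b' hb']
      · linarith [haH k b' hb']
    · intro k hk
      obtain ⟨b, hb, hle⟩ := mem_initForm.1 hk
      have hbf := hle f g hFf
      rcases hdom k b hb with ⟨b', hle, hb'⟩ | ⟨b', hle, hb'⟩
      · exact Or.inl (mem_initForm.2 ⟨b', hb', fun j c hc => by linarith [haG j c hc]⟩)
      · exact Or.inr (mem_initForm.2 ⟨b', hb', fun j c hc => by linarith [haH j c hc]⟩)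

/-! ### Finitely many circuits -/

/-- The support of a vector: the set of its finite coordinates. -/
def vecSupport (v : ι → WithTop ℝ) : Set ι := {i | v i ≠ ⊤}

/-- The nonempty supports of vectors. -/
def IsVecSupport (V : Set (ι → WithTop ℝ)) (A : Set ι) : Prop :=
  A.Nonempty ∧ ∃ v ∈ V, vecSupport v = A

/-- Every vector is a pointwise minimum of vectors of minimal support. -/
theorem IsVectorFamily.exists_circuit [Finite ι] {V : Set (ι → WithTop ℝ)} (hV : IsVectorFamily V)
    {v : ι → WithTop ℝ} (hv : v ∈ V) {e : ι} (he : v e ≠ ⊤) :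
    ∃ C ∈ V, Minimal (IsVecSupport V) (vecSupport C) ∧ (∀ i, v i ≤ C i) ∧ C e = v e := by
  induction h : (vecSupport v).ncard using Nat.strong_induction_on generalizing v with
  | _ n ih =>
  subst h
  have hvs : IsVecSupport V (vecSupport v) := ⟨⟨e, he⟩, v, hv, rfl⟩
  by_cases hmin : Minimal (IsVecSupport V) (vecSupport v)
  · exact ⟨v, hv, hmin, fun _ => le_rfl, rfl⟩
  suffices ∃ u ∈ V, vecSupport u ⊂ vecSupport v ∧ (∀ i, v i ≤ u i) ∧ u e = v e by
    obtain ⟨u, hu, hsub, hle, hue⟩ := this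
    obtain ⟨C, hC, hCmin, huC, hCe⟩ :=
      ih _ (Set.ncard_lt_ncard hsub (Set.toFinite _)) hu (hue ▸ he) rfl
    exact ⟨C, hC, hCmin, fun i => (hle i).trans (huC i), hCe.trans hue⟩
  obtain ⟨A, hAv, hA⟩ : ∃ A, A ⊂ vecSupport v ∧ IsVecSupport V A := by
    simpa [minimal_iff_forall_lt, hvs] using hmin
  obtain ⟨hne, T, hT, rfl⟩ := hA
  -- rescale `T` so that it dominates `v`, with equality at some `f`
  obtain ⟨f, hf, hmax⟩ := Set.exists_max_image (vecSupport T)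
    (fun i => (v i).untopD 0 - (T i).untopD 0) (Set.toFinite _) hne
  set c := (v f).untopD 0 - (T f).untopD 0 with hc
  set T' : ι → WithTop ℝ := fun i => T i + (c : WithTop ℝ) with hT'
  have hsupp : vecSupport T' = vecSupport T := by
    ext i; simp [vecSupport, hT']
  have hle : ∀ i, v i ≤ T' i := by
    intro i
    rcases eq_or_ne (T i) ⊤ with hi | hi
    · simp [hT', hi]
    · obtain ⟨t, ht⟩ := WithTop.ne_top_iff_exists.1 hi
      obtain ⟨a, ha⟩ := WithTop.ne_top_iff_exists.1 (hAv.subset hi)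
      have := hmax i hi
      simp only [hT', ← ht, ← ha, WithTop.untopD_coe] at this ⊢
      exact_mod_cast (by linarith : a ≤ t + c)
  have hTf : T' f = v f := by
    obtain ⟨t, ht⟩ := WithTop.ne_top_iff_exists.1 hf
    obtain ⟨a, ha⟩ := WithTop.ne_top_iff_exists.1 (hAv.subset hf)
    simp only [hT', hc, ← ht, ← ha, WithTop.untopD_coe]
    exact_mod_cast add_sub_cancel t a
  by_cases hTe : T' e = v e
  · exact ⟨T', hV.add_const T hT c, hsupp ▸ hAv, hle, hTe⟩
  -- otherwise eliminate `f` between `v` and the rescaled vector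
  obtain ⟨F, hF, hFf, hFle⟩ := hV.elim v hv T' (hV.add_const T hT c) f hTf.symm
  have hef : e ≠ f := fun h => hTe (h ▸ hTf)
  have hvF : ∀ i, v i ≤ F i := by
    intro i
    by_cases hi : i = f
    · rw [hi, hFf]; exact le_top
    · exact (le_min le_rfl (hle i)).trans (hFle i hi).1
  refine ⟨F, hF, ⟨fun i hi h => hi (top_le_iff.1 (h ▸ hvF i)), fun h => ?_⟩, hvF, ?_⟩
  · exact h (hAv.subset hf) hFf
  · rw [(hFle e hef).2 (Ne.symm hTe), min_eq_left (hle e)]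

/-- Two vectors of the same minimal support differ by a constant. -/
theorem IsVectorFamily.eq_add_const {V : Set (ι → WithTop ℝ)} (hV : IsVectorFamily V)
    {C D : ι → WithTop ℝ} (hC : C ∈ V) (hD : D ∈ V) (hmin : Minimal (IsVecSupport V) (vecSupport C))
    (hCD : vecSupport D = vecSupport C) : ∃ c : ℝ, D = fun i => C i + (c : WithTop ℝ) := by
  obtain ⟨e, he⟩ := hmin.prop.1
  obtain ⟨a, ha⟩ := WithTop.ne_top_iff_exists.1 he
  obtain ⟨b, hb⟩ := WithTop.ne_top_iff_exists.1 (show D e ≠ ⊤ from hCD.ge he)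
  refine ⟨b - a, ?_⟩
  set C' : ι → WithTop ℝ := fun i => C i + ((b - a : ℝ) : WithTop ℝ) with hC'
  have hsupp : ∀ i, C' i = ⊤ ↔ C i = ⊤ := fun i => by simp [hC']
  have hsuppD : ∀ i, D i = ⊤ ↔ C i = ⊤ := fun i => not_iff_not.1 (Set.ext_iff.1 hCD i)
  have heq : D e = C' e := by
    simp only [hC', ← ha, ← hb]
    exact_mod_cast (add_sub_cancel a b).symm
  obtain ⟨F, hF, hFe, hFle⟩ := hV.elim D hD C' (hV.add_const C hC _) e heq
  by_contra hne
  obtain ⟨i, hi⟩ := Function.ne_iff.1 hne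
  have hie : i ≠ e := fun h => hi (h ▸ heq)
  have hFi : F i ≠ ⊤ := by
    rw [(hFle i hie).2 hi]
    intro h
    rw [min_eq_top] at h
    exact hi (h.1.trans h.2.symm)
  have hsub : vecSupport F ⊆ vecSupport C := by
    intro k hk hkC
    have hke : k ≠ e := fun h => he (h ▸ hkC)
    have := (hFle k hke).1
    rw [(hsuppD k).2 hkC, (hsupp k).2 hkC, min_self, top_le_iff] at this
    exact hk this
  exact hmin.le_of_le ⟨⟨i, hFi⟩, F, hF, rfl⟩ hsub he hFe

/-- Finitely many vectors suffice to cut out the tropical linear space. -/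
theorem IsVectorFamily.exists_finite [Finite ι] {V : Set (ι → WithTop ℝ)} (hV : IsVectorFamily V) :
    ∃ C ⊆ V, C.Finite ∧ tropSet C ⊆ tropSet V := by
  have hch : ∀ A : {A // Minimal (IsVecSupport V) A}, ∃ v ∈ V, vecSupport v = A.1 :=
    fun A => A.2.prop.2
  choose r hrV hr using hch
  refine ⟨Set.range r, Set.range_subset_iff.2 hrV, Set.finite_range r, fun x hx v hv hne => ?_⟩
  obtain ⟨e, he⟩ := initForm_nonempty hne x
  obtain ⟨C, hC, hmin, hle, hCe⟩ := hV.exists_circuit hv he.1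
  obtain ⟨c, hc⟩ := hV.eq_add_const (hrV ⟨_, hmin⟩) hC (by rwa [hr]) (hr ⟨_, hmin⟩).symm
  have hnt : (initForm C x).Nontrivial := by
    have := hx (r ⟨_, hmin⟩) ⟨_, rfl⟩ (by
      obtain ⟨i, hi⟩ := hmin.prop.1
      exact ⟨i, (hr ⟨_, hmin⟩).ge hi⟩)
    rw [hc]
    rwa [initForm_add_const]
  refine hnt.mono fun j hj => ?_
  refine ⟨fun h => hj.1 (top_le_iff.1 (h ▸ hle j)), fun k => ?_⟩
  calc v j + x j ≤ C j + x j := by gcongr; exact hle j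
    _ ≤ C e + x e := hj.2 e
    _ = v e + x e := by rw [hCe]
    _ ≤ v k + x k := he.2 k

end VectorFamily

/-! ### Geometry of tropical linear spaces -/

section TropSet

variable {ι : Type*} {V : Set (ι → WithTop ℝ)}

theorem min_add_mem_tropSet {x y : ι → ℝ} (hx : x ∈ tropSet V) (hy : y ∈ tropSet V) (s t : ℝ) :
    (fun i => min (x i + s) (y i + t)) ∈ tropSet V := by
  intro v hv hne
  obtain ⟨i, hi, j, hj, hij⟩ := hx v hv hne
  obtain ⟨k, hk, l, hl, hkl⟩ := hy v hv hne
  obtain ⟨a, ha, hai⟩ := mem_initForm.1 hi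
  obtain ⟨b, hb, hbj⟩ := mem_initForm.1 hj
  obtain ⟨c, hc, hck⟩ := mem_initForm.1 hk
  obtain ⟨d, hd, hdl⟩ := mem_initForm.1 hl
  have key : ∀ (p : ι) (q : ℝ), (∀ m (r : ℝ), v m = r → q + x p ≤ r + x m) →
      q + x p + s ≤ c + y k + t → v p = q → p ∈ initForm v fun i => min (x i + s) (y i + t) := by
    intro p q hp hle hq
    refine mem_initForm.2 ⟨q, hq, fun m r hr => ?_⟩
    have h₁ := hp m r hr
    have h₂ := hck m r hr
    have h₃ : q + x p + s - r ≤ min (x m + s) (y m + t) := le_min (by linarith) (by linarith)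
    linarith [min_le_left (x p + s) (y p + t)]
  have key' : ∀ (p : ι) (q : ℝ), (∀ m (r : ℝ), v m = r → q + y p ≤ r + y m) →
      q + y p + t ≤ a + x i + s → v p = q → p ∈ initForm v fun i => min (x i + s) (y i + t) := by
    intro p q hp hle hq
    refine mem_initForm.2 ⟨q, hq, fun m r hr => ?_⟩
    have h₁ := hp m r hr
    have h₂ := hai m r hr
    have h₃ : q + y p + t - r ≤ min (x m + s) (y m + t) := le_min (by linarith) (by linarith)
    linarith [min_le_right (x p + s) (y p + t)]
  rcases le_total (a + x i + s) (c + y k + t) with h | h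
  · exact ⟨i, key i a hai h ha, j, key j b hbj (by linarith [hbj i a ha]) hb, hij⟩
  · exact ⟨k, key' k c hck h hc, l, key' l d hdl (by linarith [hdl k c hc]) hd, hkl⟩

theorem isPreconnected_tropSet [Finite ι] : IsPreconnected (tropSet V) := by
  have := Fintype.ofFinite ι
  refine isPreconnected_of_forall_pair fun x hx y hy => ?_
  obtain ⟨T, hTX, -, hxT, hyT, hT⟩ := exists_tropical_path
    (fun x hx y hy => min_add_mem_tropSet hx hy) hx hy
  exact ⟨T, hTX, hxT, hyT, hT⟩

/-- For small `ε`, the initial form of `v` at `w + ε u` consists of the elements of the initial form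
at `w` at which `u` is smallest. -/
theorem eventually_initForm_eq [Finite ι] {v : ι → WithTop ℝ} (hne : ∃ i, v i ≠ ⊤) (w u : ι → ℝ) :
    ∀ᶠ ε in 𝓝[>] (0 : ℝ), initForm v (w + ε • u) =
      {i | i ∈ initForm v w ∧ ∀ k ∈ initForm v w, u i ≤ u k} := by
  obtain ⟨i₀, hi₀⟩ := initForm_nonempty hne w
  obtain ⟨a₀, ha₀, hle₀⟩ := mem_initForm.1 hi₀
  have hfar : ∀ᶠ ε in 𝓝[>] (0 : ℝ), ∀ i ∈ initForm v w, ∀ k, k ∉ initForm v w → ∀ b : ℝ, v k = b →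
      a₀ + w i₀ + ε * u i < b + w k + ε * u k := by
    simp only [Filter.eventually_all]
    intro i hi k hk
    rcases eq_or_ne (v k) ⊤ with hkt | hkt
    · exact Filter.Eventually.of_forall fun ε b hb => by simp [hkt] at hb
    obtain ⟨b, hb⟩ := WithTop.ne_top_iff_exists.1 hkt
    have hlt : a₀ + w i₀ < b + w k := by
      by_contra! hle
      exact hk (mem_initForm.2 ⟨b, hb.symm, fun m c hc => hle.trans (hle₀ m c hc)⟩)
    have hcont : Filter.Tendsto (fun ε : ℝ => b + w k + ε * u k - (a₀ + w i₀ + ε * u i)) (𝓝[>] 0)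
        (𝓝 (b + w k + 0 * u k - (a₀ + w i₀ + 0 * u i))) :=
      (Continuous.tendsto (by fun_prop) 0).mono_left nhdsWithin_le_nhds
    filter_upwards [hcont.eventually_const_lt (u := 0) (by linarith)] with ε hε b' hb'
    obtain rfl : b = b' := by rw [← hb] at hb'; exact_mod_cast hb'
    linarith
  filter_upwards [hfar, self_mem_nhdsWithin] with ε hε hε0
  change 0 < ε at hε0
  -- all elements of the initial form at `w` have the same value at `w`
  have hval : ∀ i ∈ initForm v w, ∀ a : ℝ, v i = a → a + w i = a₀ + w i₀ := by
    intro i hi a ha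
    obtain ⟨a', ha', hle⟩ := mem_initForm.1 hi
    obtain rfl : a = a' := by rw [ha] at ha'; exact_mod_cast ha'
    exact le_antisymm (hle i₀ a₀ ha₀) (hle₀ i a ha)
  ext i
  rw [mem_initForm]
  simp only [Pi.add_apply, Pi.smul_apply, smul_eq_mul, Set.mem_ofPred_eq]
  constructor
  · rintro ⟨a, ha, hle⟩
    have hiw : i ∈ initForm v w := by
      by_contra hi
      have h₁ := hε i₀ hi₀ i hi a ha
      have h₂ := hle i₀ a₀ ha₀
      linarith
    refine ⟨hiw, fun k hk => ?_⟩
    obtain ⟨b, hb, -⟩ := mem_initForm.1 hk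
    have h₁ := hle k b hb
    have h₂ := hval i hiw a ha
    have h₃ := hval k hk b hb
    have : ε * u i ≤ ε * u k := by linarith
    exact le_of_mul_le_mul_left this hε0
  · rintro ⟨hi, hmin⟩
    obtain ⟨a, ha, -⟩ := mem_initForm.1 hi
    have h₁ := hval i hi a ha
    refine ⟨a, ha, fun k b hb => ?_⟩
    by_cases hk : k ∈ initForm v w
    · have h₂ := hval k hk b hb
      have := mul_le_mul_of_nonneg_left (hmin k hk) hε0.le
      linarith
    · linarith [hε i hi k hk b hb]

theorem attainedTwice_iff_nontrivial {u : ι → ℝ} {S : Set ι} :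
    AttainedTwice u S ↔ {i | i ∈ S ∧ ∀ k ∈ S, u i ≤ u k}.Nontrivial := by
  constructor
  · rintro ⟨i, hi, j, hj, hij, huij, hle⟩
    exact ⟨i, ⟨hi, hle⟩, j, ⟨hj, fun k hk => huij ▸ hle k hk⟩, hij⟩
  · rintro ⟨i, ⟨hi, hle⟩, j, ⟨hj, hle'⟩, hij⟩
    exact ⟨i, hi, j, hj, hij, le_antisymm (hle j hj) (hle' i hi), hle⟩

/-- The directions in which one can move inside a tropical linear space are the fan of the initial
forms. -/
theorem IsVectorFamily.coneAt_tropSet [Finite ι] (hV : IsVectorFamily V) (w : ι → ℝ) :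
    coneAt w (tropSet V) = fanOf (initFamily V w) := by
  ext u
  constructor
  · rintro hu _ ⟨v, hv, hne, rfl⟩
    obtain ⟨ε, hε, heq⟩ := ((mem_coneAt.1 hu).and (eventually_initForm_eq hne w u)).exists
    rw [attainedTwice_iff_nontrivial, ← heq]
    exact hε v hv hne
  · intro hu
    obtain ⟨C, hCV, hC, hsub⟩ := hV.exists_finite
    refine coneAt_mono hsub (mem_coneAt.2 ?_)
    have : ∀ᶠ ε in 𝓝[>] (0 : ℝ), ∀ v ∈ C, (∃ i, v i ≠ ⊤) → (initForm v (w + ε • u)).Nontrivial := by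
      rw [Filter.eventually_all_finite hC]
      intro v hv
      by_cases hne : ∃ i, v i ≠ ⊤
      · filter_upwards [eventually_initForm_eq hne w u] with ε hε _
        rw [hε, ← attainedTwice_iff_nontrivial]
        exact hu _ ⟨v, hCV hv, hne, rfl⟩
      · exact Filter.Eventually.of_forall fun _ h => absurd h hne
    exact this.mono fun ε hε => hε

/-- A tropical linear space is the support of a finite polyhedral complex: the one of the
arrangement of the hyperplanes `v i + x i = v j + x j`, for finitely many vectors `v`. -/
theorem IsVectorFamily.exists_isPolyhedralComplex [Finite ι] (hV : IsVectorFamily V) :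
    ∃ S, S.Finite ∧ IsPolyhedralComplex S ∧ support S = tropSet V := by
  obtain ⟨C, hCV, hC, hsub⟩ := hV.exists_finite
  have := hC.to_subtype
  let l : C × ι × ι → (ι → ℝ) →ₗ[ℝ] ℝ := fun p =>
    (LinearMap.proj p.2.1 : (ι → ℝ) →ₗ[ℝ] ℝ) - LinearMap.proj p.2.2
  let c : C × ι × ι → ℝ := fun p => (p.1.1 p.2.2).untopD 0 - (p.1.1 p.2.1).untopD 0
  refine exists_isPolyhedralComplex_of_signCell_subset (l := l) (c := c) fun x hx y hy => ?_
  refine hsub fun v hv hne => (hx v (hCV hv) hne).mono fun i hi => ?_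
  obtain ⟨a, ha, hle⟩ := mem_initForm.1 hi
  refine mem_initForm.2 ⟨a, ha, fun k b hb => ?_⟩
  have h₁ := (hy (⟨v, hv⟩, i, k)).1
  simp only [l, c, LinearMap.sub_apply, LinearMap.proj_apply, ha, hb, WithTop.untopD_coe] at h₁
  linarith [h₁ (by linarith [hle k b hb])]

theorem linearlyIsomorphic_of_linearEquiv {E E' : Type*} [AddCommGroup E] [Module ℝ E]
    [AddCommGroup E'] [Module ℝ E'] (e : E ≃ₗ[ℝ] E') {A : Set E} {B : Set E'}
    (h : ∀ x, e x ∈ B ↔ x ∈ A) : LinearlyIsomorphic A B := by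
  have hB : e '' A = B := by
    ext y
    constructor
    · rintro ⟨x, hx, rfl⟩
      exact (h x).2 hx
    · intro hy
      exact ⟨e.symm y, (h _).1 (by simpa using hy), by simp⟩
  have hspan : (Submodule.span ℝ A).map (e : E →ₗ[ℝ] E') = Submodule.span ℝ B := by
    rw [Submodule.map_span, ← hB]
    rfl
  exact ⟨e.ofSubmodules _ _ hspan, fun x => h x⟩

/-- The fan of an elimination family is linearly isomorphic to the Bergman fan of a matroid on an
initial segment of the natural numbers. -/
theorem IsElimFamily.exists_linearlyIsomorphic [Finite ι] {F : Set (Set ι)} (hF : IsElimFamily F) :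
    ∃ (m : ℕ) (M : Matroid (Fin m)), M.E = Set.univ ∧
      LinearlyIsomorphic (fanOf F) (bergmanFan M) := by
  obtain ⟨m, ⟨e⟩⟩ := Finite.exists_equiv_fin ι
  have hF' : IsElimFamily (Set.image e '' F) := by
    constructor
    · rintro _ ⟨S, hS, rfl⟩
      exact (hF.nonempty S hS).image e
    · rintro _ ⟨S, hS, rfl⟩ _ ⟨T, hT, rfl⟩ _ ⟨a, ha, rfl⟩ haT _ ⟨f, hf, rfl⟩ hfT
      rw [e.injective.mem_set_image] at haT hfT
      obtain ⟨U, hU, hfU, hsub, haU⟩ := hF.elim S hS T hT a ha haT f hf hfT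
      refine ⟨e '' U, ⟨U, hU, rfl⟩, ⟨f, hfU, rfl⟩, ?_, by rwa [e.injective.mem_set_image]⟩
      rw [← Set.image_union]
      exact Set.image_mono hsub
  refine ⟨m, hF'.matroid, rfl,
    linearlyIsomorphic_of_linearEquiv (LinearEquiv.funCongrLeft ℝ ℝ e.symm) fun x => ?_⟩
  have hfan : bergmanFan hF'.matroid = fanOf (Set.image e '' F) := hF'.fanOf_isCircuit
  rw [hfan]
  constructor
  · intro h S hS
    obtain ⟨_, ⟨i, hi, rfl⟩, _, ⟨j, hj, rfl⟩, hij, hx, hle⟩ := h _ ⟨S, hS, rfl⟩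
    simp only [LinearEquiv.funCongrLeft_apply, LinearMap.funLeft_apply,
      Equiv.symm_apply_apply] at hx hle
    exact ⟨i, hi, j, hj, fun h => hij (congrArg e h), hx, fun k hk => by
      simpa using hle (e k) ⟨k, hk, rfl⟩⟩
  · rintro h _ ⟨S, hS, rfl⟩
    obtain ⟨i, hi, j, hj, hij, hx, hle⟩ := h S hS
    refine ⟨e i, ⟨i, hi, rfl⟩, e j, ⟨j, hj, rfl⟩, fun h => hij (e.injective h), ?_, ?_⟩
    · simpa [LinearEquiv.funCongrLeft_apply, LinearMap.funLeft_apply] using hx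
    · rintro _ ⟨k, hk, rfl⟩
      simpa [LinearEquiv.funCongrLeft_apply, LinearMap.funLeft_apply] using hle k hk

/-- Every polyhedral complex supported on a tropical linear space is a tropical manifold. The
dimension of the star is constant on each cell, hence locally constant on the connected support. -/
theorem IsVectorFamily.exists_isTropicalManifold [Finite ι] (hV : IsVectorFamily V)
    (hne : (tropSet V).Nonempty) {S : Set (Set (ι → ℝ))} (hS : IsPolyhedralComplex S)
    (hsupp : support S = tropSet V) : ∃ d, IsTropicalManifold d S := by
  have hiso : ∀ w ∈ support S, ∃ (m : ℕ) (M : Matroid (Fin m)), M.E = Set.univ ∧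
      (LinearlyIsomorphic (support (starAt S w)) (bergmanFan M) ∨
        LinearlyIsomorphic (support (starAt S w)) (projBergmanFan M)) := by
    intro w hw
    obtain ⟨m, M, hM, h⟩ := (hV.isElimFamily w).exists_linearlyIsomorphic
    refine ⟨m, M, hM, Or.inl ?_⟩
    rwa [support_starAt hS hw, hsupp, hV.coneAt_tropSet]
  have hfan : ∀ w ∈ support S, ∃ d, IsConnectedFan d (support (starAt S w)) := by
    intro w hw
    obtain ⟨m, M, -, h⟩ := hiso w hw
    exact isConnectedFan_of_linearlyIsomorphic (support_starAt_nonempty hw) h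
  choose! d hd using hfan
  have hle : ∀ τ ∈ S, ∀ w ∈ τ, ∀ w' ∈ τ, d w ≤ d w' := by
    intro τ hτ w hw w' hw'
    obtain ⟨σ, hσ, hτσ, hdim⟩ := exists_superset_of_isConnectedFan hS (hd w ⟨τ, hτ, hw⟩) hτ hw
    rw [← hdim]
    exact cellDim_le_of_isConnectedFan hS (hd w' ⟨τ, hτ, hw'⟩) hσ (hτσ hw')
  obtain ⟨x₀, hx₀⟩ : (support S).Nonempty := hsupp ▸ hne
  have hconst : ∀ x ∈ support S, d x = d x₀ := by
    intro x hx
    have hpre : IsPreconnected (support S) := hsupp ▸ isPreconnected_tropSet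
    refine hpre.induction₂ (fun x y => d x = d y) (fun x hx => ?_)
      (fun _ _ _ _ _ _ h₁ h₂ => h₁.trans h₂) (fun _ _ _ _ h => h.symm) hx hx₀
    filter_upwards [mem_nhdsWithin_of_mem_nhds (hS.eventually_mem hx), self_mem_nhdsWithin]
      with y hy hyS
    obtain ⟨σ, hσ, hyσ⟩ := hyS
    exact le_antisymm (hle σ hσ x (hy σ hσ hyσ) y hyσ) (hle σ hσ y hyσ x (hy σ hσ hyσ))
  refine ⟨d x₀, hS, fun w hw => ?_, hiso⟩
  rw [← hconst w hw]
  exact hasDim_starAt_of_isConnectedFan hS hw (hd w hw)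

end TropSet

/-! ### Tropical linear spaces in `𝕋ⁿ` -/

section TropicalSemiring

theorem untrop_sum_eq_inf {n : ℕ} (f : Fin n → TropNum) :
    Tropical.untrop (∑ k, f k) = Finset.univ.inf (Tropical.untrop ∘ f) :=
  Finset.untrop_sum' _ _

theorem sum_le_apply {n : ℕ} (f : Fin n → TropNum) (k : Fin n) : ∑ k, f k ≤ f k := by
  rw [← Tropical.untrop_le_iff, untrop_sum_eq_inf]
  exact Finset.inf_le (f := Tropical.untrop ∘ f) (Finset.mem_univ k)

theorem eq_sum_iff {n : ℕ} (f : Fin n → TropNum) (i : Fin n) : f i = ∑ k, f k ↔ ∀ k, f i ≤ f k := by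
  refine ⟨fun h k => h ▸ sum_le_apply f k, fun h => le_antisymm ?_ (sum_le_apply f i)⟩
  rw [← Tropical.untrop_le_iff, untrop_sum_eq_inf]
  exact Finset.le_inf fun k _ => h k

theorem sum_eq_zero_iff_forall {n : ℕ} (f : Fin n → TropNum) : ∑ k, f k = 0 ↔ ∀ k, f k = 0 := by
  rw [← Tropical.untrop_injective.eq_iff, untrop_sum_eq_inf]
  change _ = (⊤ : WithTop ℝ) ↔ _
  rw [Finset.inf_eq_top_iff]
  exact ⟨fun h k => Tropical.untrop_injective (h k (Finset.mem_univ k)), fun h k _ =>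
    congrArg Tropical.untrop (h k)⟩

theorem add_mem_tropHyperplane {n : ℕ} {v x y : Fin n → TropNum} (hx : x ∈ tropHyperplane v)
    (hy : y ∈ tropHyperplane v) : x + y ∈ tropHyperplane v := by
  wlog hle : ∑ i, v i * x i ≤ ∑ i, v i * y i generalizing x y
  · rw [add_comm]
    exact this hy hx (le_of_not_ge hle)
  have hsum : ∑ i, v i * (x + y) i = ∑ i, v i * x i := by
    simp only [Pi.add_apply, mul_add, Finset.sum_add_distrib]
    exact Tropical.add_eq_left hle
  have hterm : ∀ i, v i * x i = ∑ k, v k * x k → v i * (x + y) i = ∑ k, v k * x k := by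
    intro i hi
    rw [Pi.add_apply, mul_add, ← hi]
    exact Tropical.add_eq_left (hi.le.trans (hle.trans (sum_le_apply (fun k => v k * y k) i)))
  rcases hx with h0 | ⟨i, j, hij, hi, hj⟩
  · exact Or.inl (hsum.trans h0)
  · exact Or.inr ⟨i, j, hij, (hterm i hi).trans hsum.symm, (hterm j hj).trans hsum.symm⟩

theorem zero_mem_tropHyperplane {n : ℕ} (v : Fin n → TropNum) : 0 ∈ tropHyperplane v :=
  Or.inl (by simp)

variable {n : ℕ} {V : Submodule TropNum (Fin n → TropNum)}

/-- The restrictions of the vectors of a valuated matroid to the coordinates that are not loops, in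
additive notation. -/
def restrictedVectors (V : Submodule TropNum (Fin n → TropNum)) :
    Set ({i // i ∉ infiniteCoords V} → WithTop ℝ) :=
  {u | ∃ v ∈ V, u = fun i => Tropical.untrop (v i.1)}

theorem isVectorFamily_restrictedVectors (hV : IsValuatedMatroid V) :
    IsVectorFamily (restrictedVectors V) where
  add_const := by
    rintro _ ⟨v, hv, rfl⟩ c
    refine ⟨Tropical.trop (c : WithTop ℝ) • v, V.smul_mem _ hv, funext fun i => ?_⟩
    rw [Pi.smul_apply, smul_eq_mul, Tropical.untrop_mul, Tropical.untrop_trop, add_comm]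
  elim := by
    rintro _ ⟨G, hG, rfl⟩ _ ⟨H, hH, rfl⟩ e he
    obtain ⟨F, hF, hFe, hFle⟩ := hV G hG H hH e (Tropical.untrop_injective he)
    refine ⟨_, ⟨F, hF, rfl⟩, congrArg Tropical.untrop hFe, fun i hi => ?_⟩
    obtain ⟨h₁, h₂⟩ := hFle i fun h => hi (Subtype.ext h)
    exact ⟨h₁, fun h => congrArg Tropical.untrop (h₂ fun h' => h (congrArg Tropical.untrop h'))⟩

open Classical in
/-- The point of `𝕋ⁿ` with the given finite coordinates off the loops, and `∞` at the loops. -/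
noncomputable def extendByInfinity (V : Submodule TropNum (Fin n → TropNum))
    (x : {i // i ∉ infiniteCoords V} → ℝ) : Fin n → TropNum :=
  fun i => if h : i ∈ infiniteCoords V then 0 else Tropical.trop ((x ⟨i, h⟩ : ℝ) : WithTop ℝ)

theorem mem_tropHyperplane_extendByInfinity (v : Fin n → TropNum)
    (x : {i // i ∉ infiniteCoords V} → ℝ) :
    extendByInfinity V x ∈ tropHyperplane v ↔
      ((∃ i : {i // i ∉ infiniteCoords V}, Tropical.untrop (v i) ≠ ⊤) →
        (initForm (fun i : {i // i ∉ infiniteCoords V} => Tropical.untrop (v i))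
          x).Nontrivial) := by
  set f : Fin n → TropNum := fun i => v i * extendByInfinity V x i with hf
  have hin : ∀ i, i ∈ infiniteCoords V → f i = 0 := fun i hi => by
    simp [hf, extendByInfinity, hi]
  have hout : ∀ i : {i // i ∉ infiniteCoords V},
      Tropical.untrop (f i) = Tropical.untrop (v i) + x i := fun i => by
    simp only [hf, extendByInfinity, i.2, dif_neg, not_false_eq_true, Tropical.untrop_mul,
      Tropical.untrop_trop]
  have hzero : ∀ i : {i // i ∉ infiniteCoords V}, f i = 0 ↔ Tropical.untrop (v i) = ⊤ := fun i => by
    rw [← Tropical.untrop_injective.eq_iff, hout]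
    change _ = (⊤ : WithTop ℝ) ↔ _
    simp
  -- the indices at which the value of the linear form is attained, if it is finite
  have hmin : ∀ i : {i // i ∉ infiniteCoords V},
      i ∈ initForm (fun i : {i // i ∉ infiniteCoords V} => Tropical.untrop (v i)) x ↔
        f i ≠ 0 ∧ f i = ∑ k, f k := by
    intro i
    rw [eq_sum_iff, Ne, hzero]
    refine and_congr_right fun _ => ⟨fun h k => ?_, fun h k => ?_⟩
    · by_cases hk : k ∈ infiniteCoords V
      · rw [hin k hk]
        exact le_top
      · have := h ⟨k, hk⟩
        rw [← hout, ← hout ⟨k, hk⟩] at this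
        exact this
    · rw [← hout, ← hout]
      exact h k
  change (∑ i, f i = 0 ∨ ∃ i j, i ≠ j ∧ f i = ∑ k, f k ∧ f j = ∑ k, f k) ↔ _
  constructor
  · rintro h ⟨i₀, hi₀⟩
    have hne : ∑ i, f i ≠ 0 := fun h0 => hi₀ ((hzero i₀).1 ((sum_eq_zero_iff_forall f).1 h0 i₀))
    obtain ⟨i, j, hij, hi, hj⟩ := h.resolve_left hne
    have hi' : i ∉ infiniteCoords V := fun h => hne (hi ▸ hin i h)
    have hj' : j ∉ infiniteCoords V := fun h => hne (hj ▸ hin j h)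
    exact ⟨⟨i, hi'⟩, (hmin _).2 ⟨fun h => hne (hi ▸ h), hi⟩, ⟨j, hj'⟩,
      (hmin _).2 ⟨fun h => hne (hj ▸ h), hj⟩, fun h => hij (congrArg Subtype.val h)⟩
  · intro h
    by_cases hex : ∃ i : {i // i ∉ infiniteCoords V}, Tropical.untrop (v i) ≠ ⊤
    · obtain ⟨i, hi, j, hj, hij⟩ := h hex
      exact Or.inr ⟨i, j, fun h => hij (Subtype.ext h), ((hmin i).1 hi).2, ((hmin j).1 hj).2⟩
    · push Not at hex
      refine Or.inl ((sum_eq_zero_iff_forall f).2 fun k => ?_)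
      by_cases hk : k ∈ infiniteCoords V
      · exact hin k hk
      · exact (hzero ⟨k, hk⟩).2 (hex _)

theorem mem_finitePart {x : {i // i ∉ infiniteCoords V} → ℝ} :
    x ∈ finitePart V ↔ extendByInfinity V x ∈ tropLinearSpace V := Iff.rfl

theorem finitePart_eq_tropSet (V : Submodule TropNum (Fin n → TropNum)) :
    finitePart V = tropSet (restrictedVectors V) := by
  ext x
  rw [mem_finitePart, tropLinearSpace, Set.mem_iInter₂]
  simp only [mem_tropHyperplane_extendByInfinity]
  constructor
  · rintro h _ ⟨v, hv, rfl⟩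
    exact h v hv
  · exact fun h v hv => h _ ⟨v, hv, rfl⟩

/-- The sum of points of the tropical linear space, one for each coordinate that is not a loop, is a
point at which all these coordinates are finite. -/
theorem finitePart_nonempty (V : Submodule TropNum (Fin n → TropNum)) :
    (finitePart V).Nonempty := by
  classical
  have hex : ∀ i : {i // i ∉ infiniteCoords V}, ∃ x ∈ tropLinearSpace V, x i ≠ 0 := fun i => by
    have := i.2
    simpa only [infiniteCoords, Set.mem_ofPred_eq, not_forall, exists_prop] using this
  choose y hy hyi using hex
  have hmem : ∑ i, y i ∈ tropLinearSpace V := by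
    rw [tropLinearSpace, Set.mem_iInter₂]
    intro v hv
    refine Finset.sum_induction y (· ∈ tropHyperplane v) (fun _ _ => add_mem_tropHyperplane)
      (zero_mem_tropHyperplane v) fun i _ => ?_
    exact Set.mem_iInter₂.1 (hy i) v hv
  have hfin : ∀ i : {i // i ∉ infiniteCoords V}, (∑ j, y j) i ≠ 0 := by
    intro i h
    rw [Finset.sum_apply, ← Finset.add_sum_erase _ _ (Finset.mem_univ i)] at h
    have h' : y i i = 0 := by
      refine Tropical.untrop_injective (top_le_iff.1 ?_)
      have := congrArg Tropical.untrop h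
      rw [Tropical.untrop_add] at this
      exact (this.ge.trans (min_le_left _ _))
    exact hyi i h'
  refine ⟨fun i => (Tropical.untrop ((∑ j, y j) i)).untopD 0, ?_⟩
  have heq : extendByInfinity V (fun i => (Tropical.untrop ((∑ j, y j) i)).untopD 0) =
      ∑ j, y j := by
    funext i
    by_cases hi : i ∈ infiniteCoords V
    · simp only [extendByInfinity, hi, dif_pos]
      exact (hi _ hmem).symm
    · simp only [extendByInfinity, hi, dif_neg, not_false_eq_true]
      have hne : Tropical.untrop ((∑ j, y j) i) ≠ ⊤ := fun h =>
        hfin ⟨i, hi⟩ (Tropical.untrop_injective h)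
      obtain ⟨a, ha⟩ := WithTop.ne_top_iff_exists.1 hne
      rw [← ha, WithTop.untopD_coe, ha, Tropical.trop_untrop]
  rwa [mem_finitePart, heq]

end TropicalSemiring

end TropicalConnectivity

theorem mainTheorem4 :
    -- locally connected through codimension one implies connected through codimension one
    (∀ (n : ℕ) (S : Set (Set (Fin n → ℝ))),
      TropicalConnectivity.IsPolyhedralComplex S →
      IsConnected (TropicalConnectivity.support S) →
      TropicalConnectivity.IsPure S →
      TropicalConnectivity.LocallyConnectedThroughCodimOne S →
      TropicalConnectivity.ConnectedThroughCodimOne S) ∧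
    -- connected tropical manifolds
    (∀ (n d : ℕ) (S : Set (Set (Fin n → ℝ))),
      TropicalConnectivity.IsTropicalManifold d S →
      IsConnected (TropicalConnectivity.support S) →
      TropicalConnectivity.ConnectedThroughCodimOne S) ∧
    -- tropical linear spaces, with any polyhedral structure
    (∀ (n : ℕ) (V : Submodule TropicalConnectivity.TropNum (Fin n → TropicalConnectivity.TropNum)),
      TropicalConnectivity.IsValuatedMatroid V →
      (∃ S, S.Finite ∧ TropicalConnectivity.IsPolyhedralComplex S ∧
        TropicalConnectivity.support S = TropicalConnectivity.finitePart V) ∧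
      ∀ S, TropicalConnectivity.IsPolyhedralComplex S →
        TropicalConnectivity.support S = TropicalConnectivity.finitePart V →
        (∃ d, TropicalConnectivity.IsTropicalManifold d S) ∧
        IsConnected (TropicalConnectivity.support S) ∧
        TropicalConnectivity.ConnectedThroughCodimOne S) := by
  refine ⟨fun n S hS hconn hpure hlocal =>
    TropicalConnectivity.connectedThroughCodimOne_of_locally hS hconn hpure hlocal,
    fun n d S hS hconn => hS.connectedThroughCodimOne hconn, fun n V hV => ?_⟩
  have hvec := TropicalConnectivity.isVectorFamily_restrictedVectors hV
  have hne := TropicalConnectivity.finitePart_nonempty V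
  rw [TropicalConnectivity.finitePart_eq_tropSet] at hne ⊢
  refine ⟨hvec.exists_isPolyhedralComplex, fun S hS hsupp => ?_⟩
  obtain ⟨d, hd⟩ := hvec.exists_isTropicalManifold hne hS hsupp
  have hconn : IsConnected (TropicalConnectivity.support S) :=
    hsupp ▸ ⟨hne, TropicalConnectivity.isPreconnected_tropSet⟩
  exact ⟨⟨d, hd⟩, hconn, hd.connectedThroughCodimOne hconn⟩
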